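/- Let $d\ge 1$, $h\in(0,+\infty]$ and $\mathbb{T}^d=\mathbb{R}^d/(2\pi\mathbb{Z})^d$, and let $\eta\in W^{1,\infty}(\mathbb{T}^d)$ (that is, $\eta\colon\mathbb{T}^d\to\mathbb{R}$ is Lipschitz) satisfy $$\int_{\mathbb{T}^d}\eta\,dx=0\quad\text{and}\quad \inf_{\mathbb{T}^d}\eta>-\tfrac12 h$$ (the last condition is automatic if $h=+\infty$). Set $\Omega=\{(x,y)\in\mathbb{T}^d\times\mathbb{R} : -h<y<\eta(x)\}$. For $\psi\in H^{1/2}(\mathbb{T}^d)$, let $\phi$ be the variational solution of $$\Delta_{x,y}\phi=0\ \text{ in }\Omega,\qquad \phi|_{y=\eta}=\psi,\qquad \partial_y\phi|_{y=-h}=0,$$ that is, $\nabla_{x,y}\phi\in L^2(\Omega)$, $\phi|_{y=\eta}=\psi$, and $\iint_\Omega\nabla_{x,y}\phi\cdot\nabla_{x,y}v\,dy\,dx=0$ for every $v$ with $\nabla_{x,y}v\in L^2(\Omega)$ and $v|_{y=\eta}=0$. (Here $\phi$ and $v$ are required to be square integrable on the parts of $\Omega$ of bounded depth.) Let $G(\eta)\psi=\sqrt{1+|\nabla_x\eta|^2}\,\partial_n\phi|_{y=\eta}$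 be the Dirichlet-to-Neumann operator, understood in the weak sense: for $f\in H^{1/2}(\mathbb{T}^d)$, $\int_{\mathbb{T}^d}f\,G(\eta)\psi\,dx$ denotes the duality pairing $$\int_{\mathbb{T}^d}f\,G(\eta)\psi\,dx=\iint_\Omega\nabla_{x,y}\phi\cdot\nabla_{x,y}F\,dy\,dx,$$ where $F$ is any function of the same class (square integrable on the parts of $\Omega$ of bounded depth, with $\nabla_{x,y}F\in L^2(\Omega)$) such that $F|_{y=\eta}=f$. This pairing is well defined: for all $\psi,f\in H^{1/2}(\mathbb{T}^d)$ such $\phi$ and $F$ exist, and the value does not depend on their choice. Moreover: i) For all $\psi\in H^{1/2}(\mathbb{T}^d)$, $$\left|\int_{\mathbb{T}^d}\eta\,G(\eta)\psi\,dx\right|\le\left(\int_{\mathbb{T}^d}\eta\,G(\eta)\eta\,dx\right)^{1/2}\left(\int_{\mathbb{T}^d}\psi\,G(\eta)\psi\,dx\right)^{1/2}.$$ ii) If $h<+\infty$, then $\displaystyle 0\le\int_{\mathbb{T}^d}\eta\,G(\eta)\eta\,dx\le h\,|\mathbb{T}^d|$. iii) If $h=+\infty$, then $\displaystyle 0\le\int_{\mathbb{T}^d}\eta\,G(\eta)\eta\,dx\le\Big|\inf_{x\in\mathbb{T}^d}\eta(x)\Big|\cdot|\mathbb{T}^d|$.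 -/

import Mathlib

open MeasureTheory
open scoped ContDiff

instance factTwoPiPos : Fact (0 < 2 * Real.pi) := ⟨Real.two_pi_pos⟩

/-- The torus `ℝ^d / (2πℤ)^d`, with its Lebesgue measure `volume` of total mass `(2π)^d`. -/
abbrev Torus (d : ℕ) : Type := Fin d → AddCircle (2 * Real.pi)

/-- Fourier coefficient `(2π)^{-d} ∫ e^{-i x·ξ} u(x) dx`. -/
noncomputable def torusFourierCoeff {d : ℕ} (u : Torus d → ℝ) (ξ : Fin d → ℤ) : ℂ :=
  ((2 * Real.pi : ℝ) : ℂ)⁻¹ ^ d *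
    ∫ x : Torus d, (∏ j, (fourier (-(ξ j)) (x j) : ℂ)) * ((u x : ℝ) : ℂ)

/-- Membership in the Sobolev space `H^s(𝕋^d)`, `s ≥ 0`. -/
def MemSobolev {d : ℕ} (s : ℝ) (u : Torus d → ℝ) : Prop :=
  MemLp u 2 volume ∧
    Summable fun ξ : Fin d → ℤ =>
      (1 + ∑ j, (ξ j : ℝ) ^ 2) ^ s * ‖torusFourierCoeff u ξ‖ ^ 2

/-- The fluid domain `{(x, y) : -h < y < η(x)}` with depth `h ∈ (0, +∞]`. -/
def fluidDomain {d : ℕ} (h : EReal) (η : Torus d → ℝ) : Set (Torus d × ℝ) :=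
  {p | -h < (p.2 : EReal) ∧ p.2 < η p.1}

/-- Displacement by `t` in a coordinate direction of `𝕋^d × ℝ`:
`some j` is the horizontal direction `x_j`, and `none` is the vertical direction `y`. -/
noncomputable def displacement {d : ℕ} : Option (Fin d) → ℝ → Torus d × ℝ
  | some j, t => (Pi.single j (t : AddCircle (2 * Real.pi)), 0)
  | none, t => (0, t)

/-- Classical partial derivative on `𝕋^d × ℝ`. -/
noncomputable def torusPartial {d : ℕ} (k : Option (Fin d)) (ζ : Torus d × ℝ → ℝ)
    (p : Torus d × ℝ) : ℝ :=
  deriv (fun t : ℝ => ζ (p + displacement k t)) 0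

/-- `ζ` is smooth on `𝕋^d × ℝ`, with compact support contained in `U`. -/
def IsTestFunction {d : ℕ} (U : Set (Torus d × ℝ)) (ζ : Torus d × ℝ → ℝ) : Prop :=
  ContDiff ℝ ∞ (fun q : (Fin d → ℝ) × ℝ =>
      ζ (fun j => ((q.1 j : ℝ) : AddCircle (2 * Real.pi)), q.2)) ∧
    HasCompactSupport ζ ∧ tsupport ζ ⊆ U

/-- `u` has finite Dirichlet energy in the fluid domain, with weak gradient `g ∈ L²`:
`u` is square integrable on every part of the domain of bounded depth (so that `u ∈ H¹` if `h` is
finite, while in infinite depth `u` itself need not be square integrable). -/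
structure HasFiniteEnergy {d : ℕ} (h : EReal) (η : Torus d → ℝ) (u : Torus d × ℝ → ℝ)
    (g : Torus d × ℝ → EuclideanSpace ℝ (Option (Fin d))) : Prop where
  memLp_local : ∀ R : ℝ, MemLp u 2 (volume.restrict (fluidDomain h η ∩ {p | -R < p.2}))
  memLp_grad : MemLp g 2 (volume.restrict (fluidDomain h η))
  weak_deriv : ∀ (k : Option (Fin d)) (ζ : Torus d × ℝ → ℝ),
    IsTestFunction (fluidDomain h η) ζ →
      ∫ p in fluidDomain h η, u p * torusPartial k ζ p = -∫ p in fluidDomain h η, g p k * ζ p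

/-- `u`, with weak gradient `g`, has the trace `f` on the free surface `y = η(x)`, in the sense of
Green's formula. It is enough to use the vertical component of that formula: the boundary term is
`∫ f ζ n_y dσ`, and `n_y dσ = dx` on the graph of `η`, so `f` is determined almost everywhere.
The test functions vanish near the bottom but need not vanish on the free surface. -/
def HasSurfaceTrace {d : ℕ} (h : EReal) (η : Torus d → ℝ) (u : Torus d × ℝ → ℝ)
    (g : Torus d × ℝ → EuclideanSpace ℝ (Option (Fin d))) (f : Torus d → ℝ) : Prop :=
  MemLp f 2 volume ∧
    ∀ ζ : Torus d × ℝ → ℝ, IsTestFunction {p | -h < (p.2 : EReal)} ζ →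
      ∫ p in fluidDomain h η, (u p * torusPartial none ζ p + g p none * ζ p) =
        ∫ x : Torus d, f x * ζ (x, η x)

/-- `φ`, with weak gradient `g`, is a variational solution of `Δφ = 0` in the fluid domain,
`φ = ψ` on `y = η`, `∂_y φ = 0` on `y = -h`. The variations vanish on the free surface and are
unrestricted at the bottom, which encodes the Neumann condition there. -/
structure IsVariationalSolution {d : ℕ} (h : EReal) (η ψ : Torus d → ℝ) (φ : Torus d × ℝ → ℝ)
    (g : Torus d × ℝ → EuclideanSpace ℝ (Option (Fin d))) : Prop where
  energy : HasFiniteEnergy h η φ g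
  surface : HasSurfaceTrace h η φ g ψ
  weak_eq : ∀ (v : Torus d × ℝ → ℝ) (gv : Torus d × ℝ → EuclideanSpace ℝ (Option (Fin d))),
    HasFiniteEnergy h η v gv → HasSurfaceTrace h η v gv (fun _ => 0) →
      ∫ p in fluidDomain h η, inner ℝ (g p) (gv p) = 0

/-- `a` is the value at `f` of the distribution `G(η)ψ`, the normal derivative
`√(1+|∇η|²) ∂_n φ` on `y = η` of the variational solution `φ` with data `ψ`. As usual for a harmonic
function of finite energy, the normal derivative is taken in the weak sense, by Green's formula:
`⟨G(η)ψ, f⟩ = ∬ ∇φ · ∇F` where `F` has finite energy and trace `f`. -/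
def IsDNPairing {d : ℕ} (h : EReal) (η ψ f : Torus d → ℝ) (a : ℝ) : Prop :=
  ∃ (φ F : Torus d × ℝ → ℝ) (gφ gF : Torus d × ℝ → EuclideanSpace ℝ (Option (Fin d))),
    IsVariationalSolution h η ψ φ gφ ∧ HasFiniteEnergy h η F gF ∧ HasSurfaceTrace h η F gF f ∧
      a = ∫ p in fluidDomain h η, inner ℝ (gφ p) (gF p)

open Classical in
/-- The Dirichlet-to-Neumann operator: `dirichletToNeumann h η ψ f` is `∫ f G(η)ψ dx`, the duality
pairing of `G(η)ψ ∈ H^{-1/2}` with `f ∈ H^{1/2}`. -/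
noncomputable def dirichletToNeumann {d : ℕ} (h : EReal) (η ψ f : Torus d → ℝ) : ℝ :=
  if H : ∃ a, IsDNPairing h η ψ f a then H.choose else 0

/-! The pairing of `G(η)ψ` with `f` is the Dirichlet inner product of `∇φ` with the gradient of any
extension of `f`. Taking the variational solution with data `f` as that extension turns all pairings
in i) into inner products of one Hilbert space, so i) is the Cauchy–Schwarz inequality
(`abs_dirichletToNeumann_le`). By the Dirichlet principle (`dirichletToNeumann_self_le`) the pairing
of `G(η)η` with `η` is at most the energy of any extension of `η`. The height `y` restricts to `η`
on the surface, and so does `max y c` when `c ≤ η`; the latter has energy `∫ (η - c) = -c |𝕋^d|` in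
infinite depth, since `η` has mean zero, and no more in finite depth (`hasFiniteEnergy_max`,
`dirichletToNeumann_surface_le`). The choice `c = -h` gives ii) and `c = inf η` gives iii).

Most of the work shows that the pairing is well defined. Existence of `φ` is an orthogonal
projection, which needs the gradients of functions with zero trace to form a closed subspace of
`L²`. No Poincaré inequality is used: such gradients are exactly the fields orthogonal to an
explicit family `zeroTraceConstraint`. Necessity is Green's formula; for sufficiency
(`exists_potential`) the potential is found by integrating the vertical component down from the
surface, and Fubini's theorem moves this integration onto the test function. Independence of the
choices is `IsDNPairing.unique`.

Finally, `H^{1/2}` data need an extension of finite energy (`hasExtension_of_memSobolev`). Each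
character `e^{i x·ξ}` is extended by `e^{i x·ξ + ⟨ξ⟩(y - η(x))}`. These modes are orthogonal in
infinite depth whatever `η` is, with squared norm of order `⟨ξ⟩⁻¹`; a derivative costs `⟨ξ⟩²` in the
square, which leaves the `H^{1/2}` weight `⟨ξ⟩`. Lipschitz regularity of `η` controls the chain-rule
term `∂_j η`. -/

/-! ### Covering of the torus and calculus of test functions -/

/-- The universal covering `ℝ^d × ℝ → 𝕋^d × ℝ`. -/
noncomputable def torusCover (d : ℕ) (q : (Fin d → ℝ) × ℝ) : Torus d × ℝ :=
  (fun j => ((q.1 j : ℝ) : AddCircle (2 * Real.pi)), q.2)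

/-- The direction upstairs that corresponds to `displacement k`. -/
noncomputable def coverDirection {d : ℕ} : Option (Fin d) → (Fin d → ℝ) × ℝ
  | some j => (Pi.single j 1, 0)
  | none => (0, 1)

theorem isOpenQuotientMap_torusCover (d : ℕ) : IsOpenQuotientMap (torusCover d) := by
  have h1 : IsOpenQuotientMap
      (Pi.map (fun (_ : Fin d) (x : ℝ) => (x : AddCircle (2 * Real.pi)))) :=
    IsOpenQuotientMap.piMap fun _ => QuotientAddGroup.isOpenQuotientMap_mk
  exact h1.prodMap IsOpenQuotientMap.id

theorem torusCover_add_smul {d : ℕ} (q : (Fin d → ℝ) × ℝ) (k : Option (Fin d)) (t : ℝ) :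
    torusCover d (q + t • coverDirection k) = torusCover d q + displacement k t := by
  cases k with
  | none => ext j <;> simp [torusCover, coverDirection, displacement]
  | some j =>
    ext i
    · by_cases hi : i = j
      · subst hi; simp [torusCover, coverDirection, displacement]
      · simp [torusCover, coverDirection, displacement, hi]
    · simp [torusCover, coverDirection, displacement]

theorem displacement_zero {d : ℕ} (k : Option (Fin d)) : displacement k 0 = 0 := by
  cases k <;> simp [displacement]

theorem displacement_add {d : ℕ} (k : Option (Fin d)) (s t : ℝ) :
    displacement k (s + t) = displacement k s + displacement k t := by
  cases k with
  | none => simp [displacement]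
  | some j => simp [displacement, ← Pi.single_add]

theorem continuous_displacement {d : ℕ} (k : Option (Fin d)) :
    Continuous (displacement k : ℝ → Torus d × ℝ) := by
  cases k with
  | none => exact continuous_const.prodMk continuous_id
  | some j =>
    refine Continuous.prodMk ?_ continuous_const
    exact (continuous_single j).comp (AddCircle.continuous_mk' _)

namespace IsTestFunction

variable {d : ℕ} {U : Set (Torus d × ℝ)} {ζ : Torus d × ℝ → ℝ}

theorem contDiff_comp (hζ : IsTestFunction U ζ) : ContDiff ℝ ∞ (ζ ∘ torusCover d) := hζ.1

theorem continuous (hζ : IsTestFunction U ζ) : Continuous ζ :=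
  (isOpenQuotientMap_torusCover d).isQuotientMap.continuous_iff.2 hζ.contDiff_comp.continuous

theorem mono {V : Set (Torus d × ℝ)} (hζ : IsTestFunction U ζ) (hUV : U ⊆ V) :
    IsTestFunction V ζ := ⟨hζ.1, hζ.2.1, hζ.2.2.trans hUV⟩

theorem exists_bound (hζ : IsTestFunction U ζ) : ∃ C, 0 ≤ C ∧ ∀ p, |ζ p| ≤ C := by
  obtain ⟨C, hC⟩ := hζ.2.1.exists_bound_of_continuous hζ.continuous
  exact ⟨C, (norm_nonneg _).trans (hC 0), hC⟩

theorem torusPartial_cover (hζ : IsTestFunction U ζ) (k : Option (Fin d))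
    (q : (Fin d → ℝ) × ℝ) :
    torusPartial k ζ (torusCover d q) = fderiv ℝ (ζ ∘ torusCover d) q (coverDirection k) := by
  have h : HasFDerivAt (ζ ∘ torusCover d) (fderiv ℝ (ζ ∘ torusCover d) q) q :=
    (hζ.contDiff_comp.differentiable (by simp) q).hasFDerivAt
  have h2 := (h.hasLineDerivAt (coverDirection k)).deriv
  rw [← h2]
  unfold torusPartial
  simp only [Function.comp_apply, torusCover_add_smul]

theorem hasDerivAt (hζ : IsTestFunction U ζ) (k : Option (Fin d)) (p : Torus d × ℝ) (t : ℝ) :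
    HasDerivAt (fun s => ζ (p + displacement k s))
      (torusPartial k ζ (p + displacement k t)) t := by
  obtain ⟨q, rfl⟩ := (isOpenQuotientMap_torusCover d).surjective p
  have h : HasFDerivAt (ζ ∘ torusCover d)
      (fderiv ℝ (ζ ∘ torusCover d) (q + t • coverDirection k)) (q + t • coverDirection k) :=
    (hζ.contDiff_comp.differentiable (by simp) _).hasFDerivAt
  rw [← torusCover_add_smul, hζ.torusPartial_cover]
  have h2 : HasDerivAt (fun s : ℝ => q + s • coverDirection k) (coverDirection k) t := by
    simpa using ((hasDerivAt_id t).smul_const (coverDirection k)).const_add q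
  have h3 := h.comp_hasDerivAt t h2
  simpa only [Function.comp_def, torusCover_add_smul] using h3

theorem torusPartial_eq_zero {p : Torus d × ℝ} (k : Option (Fin d)) (hp : p ∉ tsupport ζ) :
    torusPartial k ζ p = 0 := by
  have h0 : ∀ᶠ q in nhds p, ζ q = 0 := by
    filter_upwards [(isClosed_tsupport ζ).isOpen_compl.mem_nhds hp] with q hq
    exact image_eq_zero_of_notMem_tsupport hq
  have hc : Filter.Tendsto (fun t : ℝ => p + displacement k t) (nhds 0) (nhds p) := by
    have : Continuous fun t : ℝ => p + displacement k t :=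
      continuous_const.add (continuous_displacement k)
    simpa [displacement_zero] using this.tendsto 0
  have h1 : (fun t : ℝ => ζ (p + displacement k t)) =ᶠ[nhds 0] fun _ => 0 := hc.eventually h0
  unfold torusPartial
  rw [h1.deriv_eq]; simp

theorem torusPartial (hζ : IsTestFunction U ζ) (k : Option (Fin d)) :
    IsTestFunction U (torusPartial k ζ) := by
  have hs : tsupport (_root_.torusPartial k ζ) ⊆ tsupport ζ := by
    refine closure_minimal (fun p hp => ?_) (isClosed_tsupport ζ)
    by_contra h
    exact hp (torusPartial_eq_zero k h)
  refine ⟨?_, hζ.2.1.of_isClosed_subset (isClosed_tsupport _) hs, hs.trans hζ.2.2⟩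
  have : (fun q : (Fin d → ℝ) × ℝ => _root_.torusPartial k ζ (torusCover d q)) =
      fun q => fderiv ℝ (ζ ∘ torusCover d) q (coverDirection k) := by
    ext q; exact hζ.torusPartial_cover k q
  change ContDiff ℝ ∞ (fun q : (Fin d → ℝ) × ℝ => _root_.torusPartial k ζ (torusCover d q))
  rw [this]
  exact (hζ.contDiff_comp.fderiv_right (by simp)).clm_apply contDiff_const

theorem exists_depth {h : EReal} (hh : 0 < h)
    (hζ : IsTestFunction {p : Torus d × ℝ | -h < (p.2 : EReal)} ζ) :
    ∃ l u : ℝ, -h < (l : EReal) ∧ l ≤ u ∧ ∀ p ∈ tsupport ζ, l ≤ p.2 ∧ p.2 ≤ u := by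
  rcases (tsupport ζ).eq_empty_or_nonempty with he | hne
  · refine ⟨0, 0, ?_, le_rfl, by simp [he]⟩
    simpa [EReal.neg_lt_comm] using hh
  · obtain ⟨a, ha, hal⟩ := hζ.2.1.exists_isMinOn hne continuous_snd.continuousOn
    obtain ⟨b, hb, hbl⟩ := hζ.2.1.exists_isMaxOn hne continuous_snd.continuousOn
    exact ⟨a.2, b.2, hζ.2.2 ha, hal hb, fun p hp => ⟨hal hp, hbl hp⟩⟩

/-- A uniform mean value bound, used to dominate difference quotients of test functions. -/
theorem abs_sub_le (hζ : IsTestFunction U ζ) (k : Option (Fin d)) :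
    ∃ C, 0 ≤ C ∧ ∀ p t, |ζ (p + displacement k t) - ζ p| ≤ C * |t| := by
  obtain ⟨C, hC0, hC⟩ := (hζ.torusPartial k).exists_bound
  refine ⟨C, hC0, fun p t => ?_⟩
  have := Convex.norm_image_sub_le_of_norm_hasDerivWithin_le (𝕜 := ℝ)
    (f := fun s => ζ (p + displacement k s))
    (fun s _ => (hζ.hasDerivAt k p s).hasDerivWithinAt) (fun s _ => hC _) convex_univ
    (Set.mem_univ (0 : ℝ)) (Set.mem_univ t)
  simpa [displacement_zero] using this

end IsTestFunction

/-! ### Vertical primitives of test functions -/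

/-- A smooth function on `ℝ`, equal to `1` below `M` and to `0` above `M + 1`. -/
noncomputable def verticalCutoff (M y : ℝ) : ℝ := Real.smoothTransition (M + 1 - y)

theorem verticalCutoff_of_le {M y : ℝ} (hy : y ≤ M) : verticalCutoff M y = 1 :=
  Real.smoothTransition.one_of_one_le (by linarith)

theorem verticalCutoff_of_ge {M y : ℝ} (hy : M + 1 ≤ y) : verticalCutoff M y = 0 :=
  Real.smoothTransition.zero_of_nonpos (by linarith)

theorem contDiff_verticalCutoff (M : ℝ) : ContDiff ℝ ∞ (verticalCutoff M) :=
  Real.smoothTransition.contDiff.comp (contDiff_const.sub contDiff_id)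

/-- The primitive in the vertical direction that vanishes at depth `-∞`. -/
noncomputable def verticalPrimitive {d : ℕ} (χ : Torus d × ℝ → ℝ) (p : Torus d × ℝ) : ℝ :=
  ∫ y in Set.Iic p.2, χ (p.1, y)

namespace IsTestFunction

variable {d : ℕ} {U : Set (Torus d × ℝ)} {ζ : Torus d × ℝ → ℝ}

theorem hasCompactSupport_section (hζ : IsTestFunction U ζ) (x : Torus d) :
    HasCompactSupport fun y : ℝ => ζ (x, y) := by
  refine HasCompactSupport.intro (hζ.2.1.image continuous_snd) (fun y hy => ?_)
  by_contra h
  exact hy ⟨(x, y), subset_closure h, rfl⟩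

theorem integrable_section (hζ : IsTestFunction U ζ) (x : Torus d) :
    Integrable fun y : ℝ => ζ (x, y) :=
  (hζ.continuous.comp (by fun_prop : Continuous fun y : ℝ => (x, y))).integrable_of_hasCompactSupport
    (hζ.hasCompactSupport_section x)

theorem hasDerivAt_verticalPrimitive (hζ : IsTestFunction U ζ) (x : Torus d) (y : ℝ) :
    HasDerivAt (fun s => verticalPrimitive ζ (x, s)) (ζ (x, y)) y := by
  have hi := hζ.integrable_section x
  have hc : Continuous fun y : ℝ => ζ (x, y) :=
    hζ.continuous.comp (by fun_prop : Continuous fun y : ℝ => (x, y))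
  have h1 : (fun s => verticalPrimitive ζ (x, s)) =
      fun s => (∫ t in (0 : ℝ)..s, ζ (x, t)) + ∫ t in Set.Iic 0, ζ (x, t) := by
    ext s
    rw [← intervalIntegral.integral_Iic_sub_Iic hi.integrableOn hi.integrableOn]
    simp [verticalPrimitive]
  rw [h1]
  exact (intervalIntegral.integral_hasDerivAt_right (hc.intervalIntegrable _ _)
    (hc.stronglyMeasurableAtFilter _ _) hc.continuousAt).add_const _

/-- The primitive is the convolution in `y` with the Heaviside function, with `x` as a parameter;
the vertical support is compact uniformly in `x`, so smoothness passes to the convolution jointly in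
both variables. -/
theorem contDiff_verticalPrimitive (hζ : IsTestFunction U ζ) :
    ContDiff ℝ ∞ (verticalPrimitive ζ ∘ torusCover d) := by
  set g : (Fin d → ℝ) → ℝ → ℝ := fun q y => ζ (torusCover d (q, y)) with hg
  have key := MeasureTheory.contDiffOn_convolution_right_with_param (𝕜 := ℝ) (μ := volume)
    (n := ⊤) (f := Set.indicator (Set.Ici (0 : ℝ)) fun _ => (1 : ℝ)) (ContinuousLinearMap.mul ℝ ℝ)
    (g := g) (s := Set.univ) (k := Prod.snd '' tsupport ζ) isOpen_univ
    (hζ.2.1.image continuous_snd) (fun p y _ hy => by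
      by_contra h
      exact hy ⟨_, subset_closure h, rfl⟩)
    ((locallyIntegrable_const 1).indicator measurableSet_Ici)
    (by simpa using! hζ.contDiff_comp.contDiffOn)
  rw [Set.univ_prod_univ, contDiffOn_univ] at key
  convert! key using 1
  ext q
  rw [Function.comp_apply, verticalPrimitive, convolution_def,
    ← integral_sub_left_eq_self _ volume q.2, ← integral_indicator measurableSet_Iic]
  refine integral_congr_ae (Filter.Eventually.of_forall fun y => ?_)
  by_cases hy : y ≤ q.2
  · simp [hy, hg, torusCover]
  · simp [hy, hg, torusCover]

theorem verticalPrimitive_eq_zero {p : Torus d × ℝ} {l : ℝ}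
    (hl : ∀ p ∈ tsupport ζ, l ≤ p.2) (hp : p.2 < l) : verticalPrimitive ζ p = 0 := by
  refine setIntegral_eq_zero_of_forall_eq_zero fun y hy => ?_
  by_contra h
  have := hl (p.1, y) (subset_closure h)
  exact absurd (this.trans hy) (not_le.2 hp)

/-- Above the support of `ζ` the primitive is constant in `y`, in general nonzero, so the cutoff is
what makes the support compact. Near the bottom the primitive vanishes because `ζ` does. -/
theorem cutoff_verticalPrimitive {h : EReal} (hh : 0 < h)
    (hζ : IsTestFunction {p : Torus d × ℝ | -h < (p.2 : EReal)} ζ) (M : ℝ) :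
    IsTestFunction {p : Torus d × ℝ | -h < (p.2 : EReal)}
      (fun p => verticalCutoff M p.2 * verticalPrimitive ζ p) := by
  obtain ⟨l, u, hl, -, hlu⟩ := hζ.exists_depth hh
  set K : Set (Torus d × ℝ) := Set.univ ×ˢ Set.Icc l (M + 1)
  have hK : IsCompact K := isCompact_univ.prod isCompact_Icc
  have h0 : ∀ p ∉ K, verticalCutoff M p.2 * verticalPrimitive ζ p = 0 := by
    intro p hp
    have : p.2 < l ∨ M + 1 < p.2 := by
      by_contra hc
      push Not at hc
      exact hp ⟨Set.mem_univ _, hc⟩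
    rcases this with h1 | h1
    · rw [verticalPrimitive_eq_zero (fun p hp => (hlu p hp).1) h1, mul_zero]
    · rw [verticalCutoff_of_ge h1.le, zero_mul]
  have hs : tsupport (fun p : Torus d × ℝ => verticalCutoff M p.2 * verticalPrimitive ζ p) ⊆ K :=
    closure_minimal (fun p hp => by by_contra hc; exact hp (h0 p hc)) hK.isClosed
  refine ⟨?_, HasCompactSupport.intro hK h0, fun p hp => ?_⟩
  · exact ((contDiff_verticalCutoff M).comp contDiff_snd).mul hζ.contDiff_verticalPrimitive
  · exact hl.trans_le (EReal.coe_le_coe_iff.2 (hs hp).2.1)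

theorem torusPartial_cutoff_verticalPrimitive (hζ : IsTestFunction U ζ) {M : ℝ}
    {p : Torus d × ℝ} (hp : p.2 < M) :
    _root_.torusPartial none (fun p => verticalCutoff M p.2 * verticalPrimitive ζ p) p = ζ p := by
  unfold _root_.torusPartial
  have h1 : (fun t : ℝ => verticalCutoff M (p + displacement none t).2 *
      verticalPrimitive ζ (p + displacement none t)) =ᶠ[nhds 0]
      fun t => verticalPrimitive ζ (p.1, p.2 + t) := by
    have : ∀ᶠ t : ℝ in nhds 0, t < M - p.2 := eventually_lt_nhds (by linarith)
    filter_upwards [this] with t ht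
    have e : p + displacement none t = (p.1, p.2 + t) := by
      ext <;> simp [displacement]
    rw [e, verticalCutoff_of_le (by simp only; linarith), one_mul]
  rw [h1.deriv_eq]
  have h2 := (hζ.hasDerivAt_verticalPrimitive p.1 (p.2 + 0)).comp_const_add p.2 0
  simpa using h2.deriv

end IsTestFunction

/-! ### The fluid domain: integrability, linearity, restriction from infinite depth -/

section Domain

variable {d : ℕ} {h : EReal} {η : Torus d → ℝ}

theorem isOpen_aboveBottom (d : ℕ) (h : EReal) :
    IsOpen {p : Torus d × ℝ | -h < (p.2 : EReal)} :=
  isOpen_Ioi.preimage (continuous_coe_real_ereal.comp continuous_snd)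

theorem isOpen_fluidDomain (hη : Continuous η) : IsOpen (fluidDomain h η) :=
  (isOpen_aboveBottom d h).inter (isOpen_lt continuous_snd (hη.comp continuous_fst))

theorem measurableSet_fluidDomain (hη : Continuous η) : MeasurableSet (fluidDomain h η) :=
  (isOpen_fluidDomain hη).measurableSet

theorem exists_forall_le (hη : Continuous η) : ∃ M, ∀ x, η x ≤ M := by
  obtain ⟨x, hx⟩ := hη.exists_forall_ge_of_hasCompactSupport
    (HasCompactSupport.of_compactSpace η)
  exact ⟨η x, hx⟩

theorem fluidDomain_subset_aboveBottom :
    fluidDomain h η ⊆ {p : Torus d × ℝ | -h < (p.2 : EReal)} := fun _ hp => hp.1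

theorem fluidDomain_subset_top : fluidDomain h η ⊆ fluidDomain ⊤ η :=
  fun p hp => ⟨by simp, hp.2⟩

theorem measure_slab_lt_top (hη : Continuous η) (R : ℝ) :
    volume (fluidDomain h η ∩ {p | -R < p.2}) < ⊤ := by
  obtain ⟨M, hM⟩ := exists_forall_le hη
  refine (measure_mono (t := Set.univ ×ˢ Set.Icc (-R) M) ?_).trans_lt
    (isCompact_univ.prod isCompact_Icc).measure_lt_top
  intro p hp
  exact ⟨Set.mem_univ _, hp.2.le, hp.1.2.le.trans (hM _)⟩

theorem measurableSet_slab (hη : Continuous η) (R : ℝ) :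
    MeasurableSet (fluidDomain h η ∩ {p | -R < p.2}) :=
  (measurableSet_fluidDomain hη).inter (measurableSet_lt measurable_const measurable_snd)

/-- A function that is square integrable at bounded depth may be tested against bounded functions
that vanish at large depth. -/
theorem integrableOn_mul_of_depth (hη : Continuous η) {u χ : Torus d × ℝ → ℝ}
    (hu : ∀ R : ℝ, MemLp u 2 (volume.restrict (fluidDomain h η ∩ {p | -R < p.2})))
    (hχ : Continuous χ) {C l : ℝ} (hC : ∀ p, |χ p| ≤ C) (hl : ∀ p, χ p ≠ 0 → l ≤ p.2) :
    IntegrableOn (fun p => u p * χ p) (fluidDomain h η) := by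
  have hfin : IsFiniteMeasure (volume.restrict (fluidDomain h η ∩ {p | -(1 - l) < p.2})) :=
    ⟨by simpa using measure_slab_lt_top hη (1 - l)⟩
  have h1 : IntegrableOn (fun p => u p * χ p) (fluidDomain h η ∩ {p | -(1 - l) < p.2}) :=
    ((hu (1 - l)).integrable one_le_two).mul_bdd (c := C) hχ.aestronglyMeasurable
      (Filter.Eventually.of_forall hC)
  refine h1.of_forall_sdiff_eq_zero (measurableSet_fluidDomain hη) fun p hp => ?_
  by_contra hne
  have : l ≤ p.2 := hl p (right_ne_zero_of_mul hne)
  exact hp.2 ⟨hp.1, by simp only [Set.mem_ofPred_eq]; linarith⟩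

theorem IsTestFunction.integrableOn_mul {ζ : Torus d × ℝ → ℝ} {u : Torus d × ℝ → ℝ}
    (hh : 0 < h) (hη : Continuous η)
    (hζ : IsTestFunction {p : Torus d × ℝ | -h < (p.2 : EReal)} ζ)
    (hu : ∀ R : ℝ, MemLp u 2 (volume.restrict (fluidDomain h η ∩ {p | -R < p.2}))) :
    IntegrableOn (fun p => u p * ζ p) (fluidDomain h η) := by
  obtain ⟨C, -, hC⟩ := hζ.exists_bound
  obtain ⟨l, u', -, -, hl⟩ := hζ.exists_depth hh
  exact integrableOn_mul_of_depth hη hu hζ.continuous hC fun p hp => (hl p (subset_closure hp)).1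

theorem IsTestFunction.memLp {ζ : Torus d × ℝ → ℝ} {U : Set (Torus d × ℝ)}
    (hζ : IsTestFunction U ζ) : MemLp ζ 2 volume :=
  hζ.continuous.memLp_of_hasCompactSupport hζ.2.1

theorem MeasureTheory.MemLp.depth {E : Type*} [NormedAddCommGroup E] {u : Torus d × ℝ → E}
    (hu : MemLp u 2 (volume.restrict (fluidDomain h η))) (R : ℝ) :
    MemLp u 2 (volume.restrict (fluidDomain h η ∩ {p | -R < p.2})) :=
  hu.mono_measure (Measure.restrict_mono Set.inter_subset_left le_rfl)

theorem MeasureTheory.MemLp.coord {ι : Type*} [Fintype ι] {α : Type*} [MeasurableSpace α]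
    {μ : Measure α} {g : α → EuclideanSpace ℝ ι} (hg : MemLp g 2 μ) (k : ι) :
    MemLp (fun p => g p k) 2 μ :=
  (EuclideanSpace.proj k : EuclideanSpace ℝ ι →L[ℝ] ℝ).comp_memLp' hg

variable {u v : Torus d × ℝ → ℝ} {g w : Torus d × ℝ → EuclideanSpace ℝ (Option (Fin d))}
  {f f' : Torus d → ℝ}

theorem HasFiniteEnergy.sub (hh : 0 < h) (hη : Continuous η) (hu : HasFiniteEnergy h η u g)
    (hv : HasFiniteEnergy h η v w) :
    HasFiniteEnergy h η (fun p => u p - v p) (fun p => g p - w p) where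
  memLp_local R := (hu.memLp_local R).sub (hv.memLp_local R)
  memLp_grad := hu.memLp_grad.sub hv.memLp_grad
  weak_deriv k ζ hζ := by
    have hζ' := hζ.mono fluidDomain_subset_aboveBottom
    have i1 := (hζ'.torusPartial k).integrableOn_mul hh hη hu.memLp_local
    have i2 := (hζ'.torusPartial k).integrableOn_mul hh hη hv.memLp_local
    have i3 := hζ'.integrableOn_mul hh hη fun R => (hu.memLp_grad.coord k).depth R
    have i4 := hζ'.integrableOn_mul hh hη fun R => (hv.memLp_grad.coord k).depth R
    simp only [sub_mul, PiLp.sub_apply]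
    rw [integral_sub i1 i2, integral_sub i3 i4, hu.weak_deriv k ζ hζ, hv.weak_deriv k ζ hζ]
    ring

theorem HasSurfaceTrace.sub (hh : 0 < h) (hη : Continuous η)
    (hu : HasFiniteEnergy h η u g) (hv : HasFiniteEnergy h η v w)
    (huf : HasSurfaceTrace h η u g f) (hvf : HasSurfaceTrace h η v w f') :
    HasSurfaceTrace h η (fun p => u p - v p) (fun p => g p - w p) (fun x => f x - f' x) := by
  refine ⟨huf.1.sub hvf.1, fun ζ hζ => ?_⟩
  have i1 := (hζ.torusPartial none).integrableOn_mul hh hη hu.memLp_local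
  have i2 := (hζ.torusPartial none).integrableOn_mul hh hη hv.memLp_local
  have i3 := hζ.integrableOn_mul hh hη fun R => (hu.memLp_grad.coord none).depth R
  have i4 := hζ.integrableOn_mul hh hη fun R => (hv.memLp_grad.coord none).depth R
  have hc : Continuous fun x => ζ (x, η x) := hζ.continuous.comp (by fun_prop)
  obtain ⟨C, -, hC⟩ := hζ.exists_bound
  have hfi : ∀ f : Torus d → ℝ, MemLp f 2 volume → Integrable fun x => f x * ζ (x, η x) :=
    fun f hf => (hf.integrable one_le_two).mul_bdd (c := C) hc.aestronglyMeasurable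
      (Filter.Eventually.of_forall fun x => hC _)
  simp only [sub_mul, PiLp.sub_apply]
  rw [integral_sub (hfi f huf.1) (hfi f' hvf.1), ← huf.2 ζ hζ, ← hvf.2 ζ hζ]
  refine Eq.trans ?_ (integral_sub (i1.add i3) (i2.add i4))
  exact integral_congr_ae (Filter.Eventually.of_forall fun p => by
    ring)

/-- This allows every extension to be built once, in infinite depth, and then restricted: a test
function of the smaller domain is also one of the larger. -/
theorem HasFiniteEnergy.of_top (hη : Continuous η) (hu : HasFiniteEnergy ⊤ η u g) :
    HasFiniteEnergy h η u g where
  memLp_local R := (hu.memLp_local R).mono_measure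
    (Measure.restrict_mono (Set.inter_subset_inter_left _ fluidDomain_subset_top) le_rfl)
  memLp_grad := hu.memLp_grad.mono_measure (Measure.restrict_mono fluidDomain_subset_top le_rfl)
  weak_deriv k ζ hζ := by
    have key := hu.weak_deriv k ζ (hζ.mono fluidDomain_subset_top)
    rw [setIntegral_eq_of_subset_of_forall_sdiff_eq_zero (measurableSet_fluidDomain hη)
      (fluidDomain_subset_top (h := h)) fun p hp => ?_,
      setIntegral_eq_of_subset_of_forall_sdiff_eq_zero (measurableSet_fluidDomain hη)
      (fluidDomain_subset_top (h := h)) fun p hp => ?_] at key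
    · exact key
    · rw [image_eq_zero_of_notMem_tsupport fun hc => hp.2 (hζ.2.2 hc), mul_zero]
    · rw [IsTestFunction.torusPartial_eq_zero k fun hc => hp.2 (hζ.2.2 hc), mul_zero]

theorem HasSurfaceTrace.of_top (hη : Continuous η) (hu : HasSurfaceTrace ⊤ η u g f) :
    HasSurfaceTrace h η u g f := by
  refine ⟨hu.1, fun ζ hζ => ?_⟩
  rw [← hu.2 ζ (hζ.mono fun p _ => by simp)]
  refine (setIntegral_eq_of_subset_of_forall_sdiff_eq_zero (measurableSet_fluidDomain hη)
      fluidDomain_subset_top fun p hp => ?_).symm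
  have hn : p ∉ tsupport ζ := fun hc => hp.2 ⟨hζ.2.2 hc, hp.1.2⟩
  rw [IsTestFunction.torusPartial_eq_zero none hn, image_eq_zero_of_notMem_tsupport hn]
  simp

/-- The vertical weak derivative is contained in the trace formula. -/
theorem HasSurfaceTrace.weak_deriv_none (hh : 0 < h) (hη : Continuous η)
    (hu : ∀ R : ℝ, MemLp u 2 (volume.restrict (fluidDomain h η ∩ {p | -R < p.2})))
    (hg : MemLp (fun p => g p none) 2 (volume.restrict (fluidDomain h η)))
    (huf : HasSurfaceTrace h η u g f) (ζ : Torus d × ℝ → ℝ)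
    (hζ : IsTestFunction (fluidDomain h η) ζ) :
    ∫ p in fluidDomain h η, u p * torusPartial none ζ p =
      -∫ p in fluidDomain h η, g p none * ζ p := by
  have hζ' := hζ.mono fluidDomain_subset_aboveBottom
  have key := huf.2 ζ hζ'
  rw [integral_add ((hζ'.torusPartial none).integrableOn_mul hh hη hu)
    (hζ'.integrableOn_mul hh hη fun R => hg.depth R)] at key
  have h0 : ∀ x, ζ (x, η x) = 0 := fun x =>
    image_eq_zero_of_notMem_tsupport fun hc => lt_irrefl _ (hζ.2.2 hc).2
  simp only [h0, mul_zero, integral_zero] at key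
  linarith

end Domain

/-! ### Gradients of functions with zero trace as an orthogonal complement -/

section ZeroTrace

variable {d : ℕ} {h : EReal} {η : Torus d → ℝ}

/-- The vector field `(∫_{-∞}^y ∂_k ζ) e_y - ζ e_k`, cut off above `y = M`. The gradients of the
functions that vanish on the free surface are the fields orthogonal to all of these. -/
noncomputable def zeroTraceConstraint (M : ℝ) (k : Option (Fin d)) (ζ : Torus d × ℝ → ℝ)
    (p : Torus d × ℝ) : EuclideanSpace ℝ (Option (Fin d)) :=
  EuclideanSpace.single none (verticalCutoff M p.2 * verticalPrimitive (torusPartial k ζ) p) -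
    EuclideanSpace.single k (ζ p)

theorem inner_zeroTraceConstraint (M : ℝ) (k : Option (Fin d)) (ζ : Torus d × ℝ → ℝ)
    (p : Torus d × ℝ) (a : EuclideanSpace ℝ (Option (Fin d))) :
    inner ℝ (zeroTraceConstraint M k ζ p) a =
      a none * (verticalCutoff M p.2 * verticalPrimitive (torusPartial k ζ) p) - a k * ζ p := by
  simp [zeroTraceConstraint, inner_sub_left, EuclideanSpace.inner_single_left, mul_comm]

theorem memLp_zeroTraceConstraint (hh : 0 < h) (M : ℝ) (k : Option (Fin d))
    {ζ : Torus d × ℝ → ℝ} (hζ : IsTestFunction {p : Torus d × ℝ | -h < (p.2 : EReal)} ζ) :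
    MemLp (zeroTraceConstraint M k ζ) 2 volume := by
  have h1 : ∀ (k : Option (Fin d)) (f : Torus d × ℝ → ℝ), MemLp f 2 volume →
      MemLp (fun p => EuclideanSpace.single k (f p)) 2 volume := fun k f hf =>
    ((ContinuousLinearMap.toSpanSingleton ℝ (EuclideanSpace.single k (1 : ℝ))).comp_memLp' hf).ae_eq
      (Filter.Eventually.of_forall fun p => by
        ext i; by_cases hi : i = k <;> simp [hi])
  exact (h1 _ _ ((hζ.torusPartial k).cutoff_verticalPrimitive hh M).memLp).sub (h1 _ _ hζ.memLp)

/-- Let `Y` be the cut-off vertical primitive of `∂_k ζ`. Zero trace tested on `Y` gives `∫ v ∂_k ζ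
+ ∫ g_y Y = 0`, as `∂_y Y = ∂_k ζ` below `M`; the weak derivative in direction `k` replaces the
first term by `-∫ g_k ζ`. -/
theorem integral_inner_zeroTraceConstraint (hh : 0 < h) (hη : Continuous η) {M : ℝ}
    (hM : ∀ x, η x ≤ M) {v : Torus d × ℝ → ℝ}
    {g : Torus d × ℝ → EuclideanSpace ℝ (Option (Fin d))} (hv : HasFiniteEnergy h η v g)
    (h0 : HasSurfaceTrace h η v g fun _ => 0) (k : Option (Fin d)) {ζ : Torus d × ℝ → ℝ}
    (hζ : IsTestFunction (fluidDomain h η) ζ) :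
    ∫ p in fluidDomain h η, inner ℝ (zeroTraceConstraint M k ζ p) (g p) = 0 := by
  have hζ' := hζ.mono fluidDomain_subset_aboveBottom
  have hY := (hζ'.torusPartial k).cutoff_verticalPrimitive hh M
  have i1 := (hY.torusPartial none).integrableOn_mul hh hη hv.memLp_local
  have i2 := hY.integrableOn_mul hh hη fun R => (hv.memLp_grad.coord none).depth R
  have i3 := hζ'.integrableOn_mul hh hη fun R => (hv.memLp_grad.coord k).depth R
  have key := h0.2 _ hY
  rw [integral_add i1 i2] at key
  have e : ∫ p in fluidDomain h η, v p * torusPartial none (fun p => verticalCutoff M p.2 *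
      verticalPrimitive (torusPartial k ζ) p) p =
      ∫ p in fluidDomain h η, v p * torusPartial k ζ p :=
    setIntegral_congr_fun (measurableSet_fluidDomain hη) fun p hp => by
      simp only [(hζ'.torusPartial k).torusPartial_cutoff_verticalPrimitive
        (hp.2.trans_le (hM _))]
  rw [e, hv.weak_deriv k ζ hζ] at key
  simp only [zero_mul, integral_zero] at key
  simp only [inner_zeroTraceConstraint]
  rw [integral_sub i2 i3]
  linarith

/-- The primitive in the vertical direction, vanishing at height `+∞`. -/
noncomputable def upperPrimitive (G : Torus d × ℝ → ℝ) (p : Torus d × ℝ) : ℝ :=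
  ∫ s in Set.Ici p.2, G (p.1, s)

theorem stronglyMeasurable_upperPrimitive {G : Torus d × ℝ → ℝ} (hG : Measurable G) :
    StronglyMeasurable (upperPrimitive G) := by
  have h1 : Measurable (Function.uncurry fun (p : Torus d × ℝ) (s : ℝ) =>
      Set.indicator {q : (Torus d × ℝ) × ℝ | q.1.2 ≤ q.2} (fun q => G (q.1.1, q.2)) (p, s)) := by
    refine Measurable.indicator (by fun_prop) (measurableSet_le (by fun_prop) (by fun_prop))
  have h2 := h1.stronglyMeasurable.integral_prod_right (ν := (volume : Measure ℝ))
  convert! h2 using 1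
  ext p
  rw [upperPrimitive, ← integral_indicator measurableSet_Ici]
  rfl

/-- Cauchy–Schwarz against the constant `1`, read off from `∫ (m f - A)² ≥ 0`. Expanding leaves a
factor `m`, so total mass zero is a separate case. -/
theorem sq_integral_le {α : Type*} [MeasurableSpace α] {μ : Measure α} [IsFiniteMeasure μ]
    {f : α → ℝ} (hf : MemLp f 2 μ) :
    (∫ x, f x ∂μ) ^ 2 ≤ μ.real Set.univ * ∫ x, f x ^ 2 ∂μ := by
  set A := ∫ x, f x ∂μ
  set m := μ.real Set.univ
  have hm : 0 ≤ m := measureReal_nonneg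
  have i1 : Integrable f μ := hf.integrable one_le_two
  have i2 : Integrable (fun x => f x ^ 2) μ := hf.integrable_sq
  have h0 : 0 ≤ ∫ x, (m * f x - A) ^ 2 ∂μ := integral_nonneg fun x => sq_nonneg _
  have e : ∫ x, (m * f x - A) ^ 2 ∂μ = m * (m * (∫ x, f x ^ 2 ∂μ) - A ^ 2) := by
    have : ∀ x, (m * f x - A) ^ 2 = m ^ 2 * f x ^ 2 - 2 * m * A * f x + A ^ 2 := fun x => by ring
    have j1 := i2.const_mul (m ^ 2)
    have j2 := i1.const_mul (2 * m * A)
    have j3 : Integrable (fun _ : α => A ^ 2) μ := integrable_const _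
    simp only [this]
    rw [integral_add (f := fun x => m ^ 2 * f x ^ 2 - 2 * m * A * f x) (j1.sub j2) j3,
      integral_sub j1 j2, integral_const_mul, integral_const_mul, integral_const, smul_eq_mul]
    change m ^ 2 * _ - 2 * m * A * A + m * A ^ 2 = _
    ring
  rw [e] at h0
  rcases hm.eq_or_lt with h1 | h1
  · have hμ : μ = 0 := by
      rw [← Measure.measure_univ_eq_zero]
      exact (measureReal_eq_zero_iff).1 h1.symm
    simp [A, m, hμ]
  · linarith [(mul_nonneg_iff_of_pos_left h1).1 h0]

section Upper

variable {G : Torus d × ℝ → ℝ} {M : ℝ}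

theorem upperPrimitive_eq_zero (hGM : ∀ p, η p.1 ≤ p.2 → G p = 0) {p : Torus d × ℝ}
    (hp : η p.1 ≤ p.2) : upperPrimitive G p = 0 :=
  setIntegral_eq_zero_of_forall_eq_zero fun _ hs => hGM _ (hp.trans hs)

/-- On each vertical line Cauchy–Schwarz bounds the square of the primitive at height `y` by `(M -
y) ∫ G(x, ·)²`, and `M - y ≤ M + R` in the slab. The bound degenerates at infinite depth, so only
local square integrability results. -/
theorem memLp_upperPrimitive (hG : Measurable G) (hG2 : MemLp G 2 volume)
    (hM : ∀ x, η x ≤ M) (hGM : ∀ p, η p.1 ≤ p.2 → G p = 0) (R : ℝ) :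
    MemLp (upperPrimitive G) 2 (volume.restrict (fluidDomain h η ∩ {p | -R < p.2})) := by
  rw [memLp_two_iff_integrable_sq (stronglyMeasurable_upperPrimitive hG).aestronglyMeasurable]
  have hsq : Integrable (fun p => G p ^ 2) (volume.prod volume) := hG2.integrable_sq
  have hH : Integrable (fun x : Torus d => ∫ s, G (x, s) ^ 2) := hsq.integral_prod_left
  have hsub : fluidDomain h η ∩ {p | -R < p.2} ⊆ Set.univ ×ˢ Set.Icc (-R) M := fun p hp =>
    ⟨Set.mem_univ _, hp.2.le, hp.1.2.le.trans (hM _)⟩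
  have hdom : IntegrableOn (fun p : Torus d × ℝ => (M + R) * ∫ s, G (p.1, s) ^ 2)
      (Set.univ ×ˢ Set.Icc (-R) M) := by
    have h1 : Integrable (fun p : Torus d × ℝ => (M + R) * ∫ s, G (p.1, s) ^ 2)
      ((volume : Measure (Torus d)).prod (volume.restrict (Set.Icc (-R) M))) :=
      ((hH.comp_fst _).const_mul _)
    rw [IntegrableOn, Measure.volume_eq_prod, ← Measure.prod_restrict, Measure.restrict_univ]
    exact h1
  have hae : ∀ᵐ x : Torus d, Integrable (fun s => G (x, s) ^ 2) := hsq.prod_right_ae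
  have hae2 : ∀ᵐ p : Torus d × ℝ, Integrable (fun s => G (p.1, s) ^ 2) :=
    Measure.quasiMeasurePreserving_fst.ae hae
  refine Integrable.mono' (hdom.mono_set hsub)
    ((stronglyMeasurable_upperPrimitive hG).pow 2).aestronglyMeasurable ?_
  have hmem : ∀ᵐ p ∂(volume.restrict (fluidDomain h η ∩ {p | -R < p.2})),
      p ∈ (Set.univ ×ˢ Set.Icc (-R) M : Set (Torus d × ℝ)) :=
    (ae_restrict_mem (MeasurableSet.univ.prod measurableSet_Icc)).filter_mono
      (ae_mono (Measure.restrict_mono hsub le_rfl))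
  filter_upwards [ae_restrict_of_ae hae2, hmem] with p hp hpm
  obtain ⟨x, y⟩ := p
  simp only [Set.mem_prod, Set.mem_univ, true_and, Set.mem_Icc] at hpm
  rw [Real.norm_of_nonneg (sq_nonneg _)]
  have e : upperPrimitive G (x, y) = ∫ s in Set.Icc y M, G (x, s) := by
    refine setIntegral_eq_of_subset_of_forall_sdiff_eq_zero measurableSet_Ici
      Set.Icc_subset_Ici_self fun s hs => hGM _ ?_
    have : ¬ s ≤ M := fun hc => hs.2 ⟨hs.1, hc⟩
    exact (hM x).trans (not_le.1 this).le
  have hms : Measurable fun s => G (x, s) := hG.comp measurable_prodMk_left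
  have hL : MemLp (fun s => G (x, s)) 2 (volume.restrict (Set.Icc y M)) := by
    rw [memLp_two_iff_integrable_sq hms.aestronglyMeasurable]
    exact hp.integrableOn
  rw [e]
  refine (sq_integral_le hL).trans ?_
  have hr : (volume.restrict (Set.Icc y M)).real Set.univ = M - y := by
    simp [measureReal_def, hpm.2]
  rw [hr]
  refine mul_le_mul (by linarith [hpm.1]) ?_ (integral_nonneg fun s => sq_nonneg _)
    (by linarith [hpm.1, hpm.2])
  exact setIntegral_le_integral hp (Filter.Eventually.of_forall fun s => sq_nonneg _)

/-- The Fubini theorem for the vertical primitives. -/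
theorem integral_upperPrimitive_mul (hη : Continuous η) (hh : 0 < h) (hG : Measurable G)
    (hG2 : MemLp G 2 volume) (hM : ∀ x, η x ≤ M) (hGM : ∀ p, η p.1 ≤ p.2 → G p = 0)
    {χ : Torus d × ℝ → ℝ} (hχ : IsTestFunction {p : Torus d × ℝ | -h < (p.2 : EReal)} χ) :
    ∫ p in fluidDomain h η, upperPrimitive G p * χ p =
      ∫ p, G p * (verticalCutoff M p.2 * verticalPrimitive χ p) := by
  obtain ⟨l, u, hl, -, hlu⟩ := hχ.exists_depth hh
  have hl0 : ∀ p : Torus d × ℝ, p.2 < l → χ p = 0 := fun p hp => by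
    by_contra hne
    exact absurd (hlu p (subset_closure hne)).1 (not_le.2 hp)
  have hzero : ∀ p ∉ fluidDomain h η, upperPrimitive G p * χ p = 0 := by
    intro p hp
    by_cases h1 : η p.1 ≤ p.2
    · rw [upperPrimitive_eq_zero hGM h1, zero_mul]
    · by_cases h2 : p.2 < l
      · rw [hl0 p h2, mul_zero]
      · exact absurd ⟨hl.trans_le (EReal.coe_le_coe_iff.2 (not_lt.1 h2)), not_le.1 h1⟩ hp
  have hint : Integrable (fun p => upperPrimitive G p * χ p) (volume.prod volume) :=
    (integrableOn_iff_integrable_of_support_subset fun p hp => by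
      by_contra hc; exact hp (hzero p hc)).1
      (hχ.integrableOn_mul hh hη (memLp_upperPrimitive hG hG2 hM hGM))
  have hY := hχ.cutoff_verticalPrimitive hh M
  have hint2 : Integrable (fun p => G p * (verticalCutoff M p.2 * verticalPrimitive χ p))
      (volume.prod volume) := hG2.integrable_mul hY.memLp
  -- `G` is only square integrable, so Fubini's theorem is applied to its truncation to `l ≤ y ≤ M`.
  -- Nothing is lost: `χ(x, y) ≠ 0` and `y ≤ s` force `s ≥ l`, and `G` vanishes above `M`.
  have hcut : Integrable (fun p : Torus d × ℝ => Set.indicator (Set.univ ×ˢ Set.Icc l M) G p)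
      (volume.prod volume) := by
    rw [integrable_indicator_iff (MeasurableSet.univ.prod measurableSet_Icc)]
    have : IsFiniteMeasure ((volume.prod volume).restrict
        (Set.univ ×ˢ Set.Icc l M : Set (Torus d × ℝ))) :=
      ⟨by
        have hK : IsCompact (Set.univ ×ˢ Set.Icc l M : Set (Torus d × ℝ)) :=
          isCompact_univ.prod isCompact_Icc
        rw [Measure.restrict_apply_univ]
        exact hK.measure_lt_top⟩
    exact (hG2.restrict _).integrable one_le_two
  rw [setIntegral_eq_integral_of_forall_compl_eq_zero hzero, Measure.volume_eq_prod,
    integral_prod _ hint, integral_prod _ hint2]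
  refine integral_congr_ae ?_
  filter_upwards [hcut.prod_right_ae] with x hx
  have hk : Integrable (Function.uncurry fun y s : ℝ => Set.indicator
      {q : ℝ × ℝ | q.1 ≤ q.2} (fun q => χ (x, q.1) *
        Set.indicator (Set.univ ×ˢ Set.Icc l M) G (x, q.2)) (y, s)) (volume.prod volume) :=
    ((hχ.integrable_section x).mul_prod hx).indicator
      (measurableSet_le measurable_fst measurable_snd)
  have hk' : ∀ y s : ℝ, Set.indicator {q : ℝ × ℝ | q.1 ≤ q.2} (fun q => χ (x, q.1) *
      Set.indicator (Set.univ ×ˢ Set.Icc l M) G (x, q.2)) (y, s) =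
      if y ≤ s then G (x, s) * χ (x, y) else 0 := by
    intro y s
    by_cases hys : y ≤ s
    · rw [Set.indicator_of_mem (by exact hys), if_pos hys]
      by_cases hy : y < l
      · simp [hl0 (x, y) hy]
      · by_cases hs : s ≤ M
        · have hm : (x, s) ∈ (Set.univ ×ˢ Set.Icc l M : Set (Torus d × ℝ)) :=
            ⟨Set.mem_univ _, (not_lt.1 hy).trans hys, hs⟩
          rw [Set.indicator_of_mem hm, mul_comm]
        · rw [hGM (x, s) ((hM x).trans (not_le.1 hs).le)]
          rw [Set.indicator_of_notMem (fun hc => hs hc.2.2)]; simp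
    · rw [Set.indicator_of_notMem (by exact hys), if_neg hys]
  have hswap := integral_integral_swap hk
  simp only [hk'] at hswap
  convert! hswap using 2
  · ext y
    rw [upperPrimitive, ← integral_mul_const, ← integral_indicator measurableSet_Ici]
    exact integral_congr_ae (Filter.Eventually.of_forall fun s => by
      simp [Set.indicator_apply])
  · ext s
    by_cases hs : s ≤ M
    · rw [verticalCutoff_of_le hs, one_mul, verticalPrimitive, ← integral_const_mul,
        ← integral_indicator measurableSet_Iic]
      exact integral_congr_ae (Filter.Eventually.of_forall fun y => by
        simp [Set.indicator_apply])
    · simp [hGM (x, s) ((hM x).trans (not_le.1 hs).le)]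

end Upper

theorem verticalPrimitive_torusPartial {U : Set (Torus d × ℝ)} {ζ : Torus d × ℝ → ℝ}
    (hζ : IsTestFunction U ζ) (p : Torus d × ℝ) :
    verticalPrimitive (torusPartial none ζ) p = ζ p := by
  have hd : ∀ y : ℝ, HasDerivAt (fun s : ℝ => ζ (p.1, s)) (torusPartial none ζ (p.1, y)) y := by
    intro y
    have := hζ.hasDerivAt none (p.1, 0) y
    simpa [displacement] using this
  have hdc : ContDiff ℝ 1 fun s : ℝ => ζ (p.1, s) := by
    rw [contDiff_one_iff_deriv]
    refine ⟨fun y => (hd y).differentiableAt, ?_⟩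
    rw [show deriv (fun s : ℝ => ζ (p.1, s)) = fun y => torusPartial none ζ (p.1, y) from
      funext fun y => (hd y).deriv]
    exact (hζ.torusPartial none).continuous.comp (by fun_prop)
  have h1 := (hζ.hasCompactSupport_section p.1).integral_Iic_deriv_eq hdc p.2
  simp only [fun y => (hd y).deriv] at h1
  exact h1

/-- A square integrable field orthogonal to all the constraints is the gradient of a function that
vanishes on the free surface. -/
theorem exists_potential (hh : 0 < h) (hη : Continuous η) {M : ℝ} (hM : ∀ x, η x ≤ M)
    {g : Torus d × ℝ → EuclideanSpace ℝ (Option (Fin d))} (hgm : Measurable g)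
    (hg : MemLp g 2 (volume.restrict (fluidDomain h η)))
    (horth : ∀ k ζ, IsTestFunction (fluidDomain h η) ζ →
      ∫ p in fluidDomain h η, inner ℝ (zeroTraceConstraint M k ζ p) (g p) = 0) :
    ∃ v, HasFiniteEnergy h η v g ∧ HasSurfaceTrace h η v g fun _ => 0 := by
  have hΩ := measurableSet_fluidDomain (h := h) hη
  -- The sign makes the upper primitive equal to `-∫_y^η g_y`, which is the potential vanishing at
  -- the surface.
  set G : Torus d × ℝ → ℝ := (fluidDomain h η).indicator fun p => -g p none with hGdef
  have hG : Measurable G := by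
    refine Measurable.indicator ?_ hΩ
    fun_prop
  have hG2 : MemLp G 2 volume := (memLp_indicator_iff_restrict hΩ).2 (hg.coord none).neg
  have hGM : ∀ p, η p.1 ≤ p.2 → G p = 0 := fun p hp =>
    Set.indicator_of_notMem (fun hc => absurd hc.2 (not_lt.2 hp)) _
  have key : ∀ χ, IsTestFunction {p : Torus d × ℝ | -h < (p.2 : EReal)} χ →
      ∫ p in fluidDomain h η, upperPrimitive G p * χ p =
        -∫ p in fluidDomain h η, g p none * (verticalCutoff M p.2 * verticalPrimitive χ p) := by
    intro χ hχ
    rw [integral_upperPrimitive_mul hη hh hG hG2 hM hGM hχ, ← integral_neg,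
      ← integral_indicator hΩ]
    refine integral_congr_ae (Filter.Eventually.of_forall fun p => ?_)
    by_cases hp : p ∈ fluidDomain h η <;> simp [hGdef, hp]
  have hv := memLp_upperPrimitive (h := h) hG hG2 hM hGM
  refine ⟨upperPrimitive G, ⟨hv, hg, fun k ζ hζ => ?_⟩, MemLp.zero', fun ζ hζ => ?_⟩
  · have hζ' := hζ.mono fluidDomain_subset_aboveBottom
    -- With `χ = ∂_k ζ`, the Fubini identity turns the weak derivative in direction `k` into exactly
    -- the orthogonality to the constraint of `k` and `ζ`.
    rw [key _ (hζ'.torusPartial k)]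
    have h0 := horth k ζ hζ
    simp only [inner_zeroTraceConstraint] at h0
    rw [integral_sub (((hζ'.torusPartial k).cutoff_verticalPrimitive hh M).integrableOn_mul hh hη
      fun R => (hg.coord none).depth R)
      (hζ'.integrableOn_mul hh hη fun R => (hg.coord k).depth R)] at h0
    linarith
  -- With `χ = ∂_y ζ` the primitive is `ζ` itself, even when `ζ` does not vanish on the surface;
  -- hence the trace is zero without further use of the constraints.
  · have e : ∫ p in fluidDomain h η,
        g p none * (verticalCutoff M p.2 * verticalPrimitive (torusPartial none ζ) p) =
        ∫ p in fluidDomain h η, g p none * ζ p :=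
      setIntegral_congr_fun hΩ fun p hp => by
        simp only [verticalPrimitive_torusPartial hζ, verticalCutoff_of_le (hp.2.le.trans (hM _)),
          one_mul]
    rw [integral_add ((hζ.torusPartial none).integrableOn_mul hh hη hv)
      (hζ.integrableOn_mul hh hη fun R => (hg.coord none).depth R), key _ (hζ.torusPartial none), e]
    simp

end ZeroTrace

/-! ### Variational solutions, the pairing and the Dirichlet principle -/

section Variational

variable {d : ℕ} {h : EReal} {η ψ f : Torus d → ℝ}

theorem inner_toLp {α E : Type*} [MeasurableSpace α] {μ : Measure α} [NormedAddCommGroup E]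
    [InnerProductSpace ℝ E] {u v : α → E} (hu : MemLp u 2 μ) (hv : MemLp v 2 μ) :
    inner ℝ (hu.toLp u) (hv.toLp v) = ∫ x, inner ℝ (u x) (v x) ∂μ := by
  rw [L2.inner_def]
  refine integral_congr_ae ?_
  filter_upwards [hu.coeFn_toLp, hv.coeFn_toLp] with x h1 h2
  rw [h1, h2]

/-- Orthogonal projection onto the solution space of a family of linear equations. -/
theorem exists_sub_orthogonal {H : Type*} [NormedAddCommGroup H] [InnerProductSpace ℝ H]
    [CompleteSpace H] (S : Set H) (a : H) :
    ∃ w : H, (∀ z ∈ S, inner ℝ z w = 0) ∧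
      ∀ u : H, (∀ z ∈ S, inner ℝ z u = 0) → inner ℝ (a - w) u = 0 := by
  -- The solution space is `Sᗮ`, which is closed for any `S`; `w` is the projection of `a` onto it.
  refine ⟨(Submodule.span ℝ S)ᗮ.starProjection a, fun z hz => ?_, fun u hu => ?_⟩
  · exact (Submodule.mem_orthogonal _ _).1 (Submodule.starProjection_apply_mem _ _) _
      (Submodule.subset_span hz)
  · refine (Submodule.mem_orthogonal' _ _).1 (Submodule.sub_starProjection_mem_orthogonal _) _ ?_
    rw [Submodule.mem_orthogonal]
    intro z hz
    induction hz using Submodule.span_induction with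
    | mem z hz => exact hu z hz
    | zero => simp
    | add x y _ _ hx hy => rw [inner_add_left, hx, hy, add_zero]
    | smul a x _ hx => rw [inner_smul_left, hx, mul_zero]

/-- The Dirichlet principle: data that have an extension of finite energy have a variational
solution. -/
theorem exists_isVariationalSolution (hh : 0 < h) (hη : Continuous η) {F : Torus d × ℝ → ℝ}
    {gF : Torus d × ℝ → EuclideanSpace ℝ (Option (Fin d))} (hF : HasFiniteEnergy h η F gF)
    (hFψ : HasSurfaceTrace h η F gF ψ) : ∃ φ gφ, IsVariationalSolution h η ψ φ gφ := by
  obtain ⟨M, hM⟩ := exists_forall_le hη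
  set μ := volume.restrict (fluidDomain h η)
  have hZ : ∀ (k : Option (Fin d)) (ζ : Torus d × ℝ → ℝ), IsTestFunction (fluidDomain h η) ζ →
      MemLp (zeroTraceConstraint M k ζ) 2 μ := fun k ζ hζ =>
    (memLp_zeroTraceConstraint hh M k (hζ.mono fluidDomain_subset_aboveBottom)).restrict _
  set S : Set (Lp (EuclideanSpace ℝ (Option (Fin d))) 2 μ) :=
    {z | ∃ k ζ, ∃ hζ : IsTestFunction (fluidDomain h η) ζ, z = (hZ k ζ hζ).toLp _}
  -- `w` is the projection of `∇F` onto the gradients of functions with zero trace. With `v` its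
  -- potential, `F - v` keeps the trace of `F`, and its gradient is orthogonal to all admissible
  -- variations.
  obtain ⟨w, hwS, hperp⟩ := exists_sub_orthogonal S (hF.memLp_grad.toLp gF)
  have hwL : MemLp w 2 μ := Lp.memLp w
  have hwt : hwL.toLp w = w := Lp.toLp_coeFn w hwL
  obtain ⟨v, hv, hv0⟩ := exists_potential hh hη hM (Lp.stronglyMeasurable w).measurable hwL
    fun k ζ hζ => by
      rw [← inner_toLp (hZ k ζ hζ) hwL, hwt]
      exact hwS _ ⟨k, ζ, hζ, rfl⟩
  refine ⟨_, _, hF.sub hh hη hv, by simpa using HasSurfaceTrace.sub hh hη hF hv hFψ hv0,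
    fun v' gv' hv' hv0' => ?_⟩
  refine (inner_toLp (hF.memLp_grad.sub hwL) hv'.memLp_grad).symm.trans ?_
  have e : (hF.memLp_grad.sub hwL).toLp _ = hF.memLp_grad.toLp gF - w := by
    conv_rhs => rw [← hwt]
    rfl
  rw [e]
  refine hperp _ ?_
  rintro z ⟨k, ζ, hζ, rfl⟩
  rw [inner_toLp]
  exact integral_inner_zeroTraceConstraint hh hη hM hv' hv0' k hζ

theorem integral_inner_sub_right {α E : Type*} [MeasurableSpace α] {μ : Measure α}
    [NormedAddCommGroup E] [InnerProductSpace ℝ E] {u v w : α → E} (hu : MemLp u 2 μ)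
    (hv : MemLp v 2 μ) (hw : MemLp w 2 μ) :
    ∫ x, inner ℝ (u x) (v x - w x) ∂μ =
      ∫ x, inner ℝ (u x) (v x) ∂μ - ∫ x, inner ℝ (u x) (w x) ∂μ := by
  rw [← inner_toLp hu hv, ← inner_toLp hu hw, ← inner_sub_right, ← MemLp.toLp_sub, inner_toLp]
  rfl

/-- The difference of two solutions has zero trace, so it is admissible in both weak equations;
subtracting them gives `‖g - g'‖² = 0`. -/
theorem IsVariationalSolution.grad_unique (hh : 0 < h) (hη : Continuous η)
    {φ φ' : Torus d × ℝ → ℝ} {g g' : Torus d × ℝ → EuclideanSpace ℝ (Option (Fin d))}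
    (hφ : IsVariationalSolution h η ψ φ g) (hφ' : IsVariationalSolution h η ψ φ' g') :
    g =ᵐ[volume.restrict (fluidDomain h η)] g' := by
  have h1 := hφ.energy.memLp_grad
  have h2 := hφ'.energy.memLp_grad
  have hd := hφ.energy.sub hh hη hφ'.energy
  have ht := HasSurfaceTrace.sub hh hη hφ.energy hφ'.energy hφ.surface hφ'.surface
  simp only [sub_self] at ht
  have e1 := hφ.weak_eq _ _ hd ht
  have e2 := hφ'.weak_eq _ _ hd ht
  replace e1 := (inner_toLp h1 (h1.sub h2)).trans e1
  replace e2 := (inner_toLp h2 (h1.sub h2)).trans e2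
  have e3 : inner ℝ (h1.toLp g - h2.toLp g') (h1.toLp g - h2.toLp g') = 0 := by
    rw [inner_sub_left, ← MemLp.toLp_sub]
    exact sub_eq_zero.2 (e1.trans e2.symm)
  rw [inner_self_eq_zero, sub_eq_zero] at e3
  exact (MemLp.toLp_eq_toLp_iff h1 h2).1 e3

/-- Two extensions of `f` differ by a variation with zero trace, to which `∇φ` is orthogonal; the
choice of `φ` does not matter because its gradient is unique. -/
theorem IsDNPairing.unique (hh : 0 < h) (hη : Continuous η) {a b : ℝ}
    (ha : IsDNPairing h η ψ f a) (hb : IsDNPairing h η ψ f b) : a = b := by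
  obtain ⟨φ, F, gφ, gF, hφ, hF, hFf, rfl⟩ := ha
  obtain ⟨φ', F', gφ', gF', hφ', hF', hFf', rfl⟩ := hb
  have e1 := hφ.weak_eq _ _ (hF.sub hh hη hF')
    (by simpa using HasSurfaceTrace.sub hh hη hF hF' hFf hFf')
  rw [integral_inner_sub_right hφ.energy.memLp_grad hF.memLp_grad hF'.memLp_grad,
    sub_eq_zero] at e1
  rw [e1]
  refine integral_congr_ae ?_
  filter_upwards [hφ.grad_unique hh hη hφ'] with p hp
  rw [hp]

theorem IsDNPairing.dirichletToNeumann_eq (hh : 0 < h) (hη : Continuous η) {a : ℝ}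
    (ha : IsDNPairing h η ψ f a) : dirichletToNeumann h η ψ f = a := by
  have H : ∃ a, IsDNPairing h η ψ f a := ⟨a, ha⟩
  rw [dirichletToNeumann, dif_pos H]
  exact H.choose_spec.unique hh hη ha

/-- `f` is the trace of a function of finite energy. -/
def HasExtension (h : EReal) (η f : Torus d → ℝ) : Prop :=
  ∃ F gF, HasFiniteEnergy h η F gF ∧ HasSurfaceTrace h η F gF f

theorem existsUnique_isDNPairing (hh : 0 < h) (hη : Continuous η) (hψ : HasExtension h η ψ)
    (hf : HasExtension h η f) : ∃! a : ℝ, IsDNPairing h η ψ f a := by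
  obtain ⟨F, gF, hF, hFψ⟩ := hψ
  obtain ⟨E, gE, hE, hEf⟩ := hf
  obtain ⟨φ, gφ, hφ⟩ := exists_isVariationalSolution hh hη hF hFψ
  have : IsDNPairing h η ψ f _ := ⟨φ, E, gφ, gE, hφ, hE, hEf, rfl⟩
  exact ⟨_, this, fun b hb => hb.unique hh hη this⟩

/-- Extending `f` by its own variational solution `θ` makes the three pairings equal to `⟨∇φ, ∇θ⟩`,
`‖∇θ‖²` and `‖∇φ‖²`. -/
theorem abs_dirichletToNeumann_le (hh : 0 < h) (hη : Continuous η) (hψ : HasExtension h η ψ)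
    (hf : HasExtension h η f) :
    |dirichletToNeumann h η ψ f| ≤
      Real.sqrt (dirichletToNeumann h η f f) * Real.sqrt (dirichletToNeumann h η ψ ψ) := by
  obtain ⟨F, gF, hF, hFψ⟩ := hψ
  obtain ⟨E, gE, hE, hEf⟩ := hf
  obtain ⟨φ, gφ, hφ⟩ := exists_isVariationalSolution hh hη hF hFψ
  obtain ⟨θ, gθ, hθ⟩ := exists_isVariationalSolution hh hη hE hEf
  rw [IsDNPairing.dirichletToNeumann_eq (f := f) hh hη
      ⟨φ, θ, gφ, gθ, hφ, hθ.energy, hθ.surface, rfl⟩,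
    IsDNPairing.dirichletToNeumann_eq (f := f) hh hη
      ⟨θ, θ, gθ, gθ, hθ, hθ.energy, hθ.surface, rfl⟩,
    IsDNPairing.dirichletToNeumann_eq (f := ψ) hh hη
      ⟨φ, φ, gφ, gφ, hφ, hφ.energy, hφ.surface, rfl⟩,
    ← inner_toLp hφ.energy.memLp_grad hθ.energy.memLp_grad,
    ← inner_toLp hθ.energy.memLp_grad hθ.energy.memLp_grad,
    ← inner_toLp hφ.energy.memLp_grad hφ.energy.memLp_grad,
    real_inner_self_eq_norm_sq, real_inner_self_eq_norm_sq, Real.sqrt_sq (norm_nonneg _),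
    Real.sqrt_sq (norm_nonneg _)]
  exact (abs_real_inner_le_norm _ _).trans_eq (mul_comm _ _)

/-- The variational solution minimizes the Dirichlet energy. -/
theorem dirichletToNeumann_self_le (hh : 0 < h) (hη : Continuous η) {F : Torus d × ℝ → ℝ}
    {gF : Torus d × ℝ → EuclideanSpace ℝ (Option (Fin d))} (hF : HasFiniteEnergy h η F gF)
    (hFψ : HasSurfaceTrace h η F gF ψ) :
    0 ≤ dirichletToNeumann h η ψ ψ ∧
      dirichletToNeumann h η ψ ψ ≤ ∫ p in fluidDomain h η, ‖gF p‖ ^ 2 := by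
  obtain ⟨φ, gφ, hφ⟩ := exists_isVariationalSolution hh hη hF hFψ
  have h1 := IsDNPairing.dirichletToNeumann_eq (f := ψ) hh hη
    ⟨φ, φ, gφ, gφ, hφ, hφ.energy, hφ.surface, rfl⟩
  -- The same pairing computed with the competitor `F`: `‖∇φ‖² = ⟨∇φ, ∇F⟩ ≤ ‖∇φ‖ ‖∇F‖`.
  have h2 := IsDNPairing.dirichletToNeumann_eq (f := ψ) hh hη
    ⟨φ, F, gφ, gF, hφ, hF, hFψ, rfl⟩
  simp only [← real_inner_self_eq_norm_sq]
  rw [← inner_toLp hF.memLp_grad hF.memLp_grad, real_inner_self_eq_norm_sq]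
  rw [← inner_toLp hφ.energy.memLp_grad hφ.energy.memLp_grad, real_inner_self_eq_norm_sq] at h1
  rw [← inner_toLp hφ.energy.memLp_grad hF.memLp_grad] at h2
  have h3 := real_inner_le_norm (hφ.energy.memLp_grad.toLp gφ) (hF.memLp_grad.toLp gF)
  rw [← h2, h1] at h3
  rw [h1]
  refine ⟨sq_nonneg _, ?_⟩
  nlinarith [norm_nonneg (hφ.energy.memLp_grad.toLp gφ), norm_nonneg (hF.memLp_grad.toLp gF),
    sq_nonneg (‖hφ.energy.memLp_grad.toLp gφ‖ - ‖hF.memLp_grad.toLp gF‖)]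

end Variational

/-! ### Finite energy and trace for piecewise regular functions -/

section Lipschitz

variable {d : ℕ} {η : Torus d → ℝ} {u D ζ : Torus d × ℝ → ℝ} {U : Set (Torus d × ℝ)}

theorem memLp_euclidean {α ι : Type*} [Fintype ι] [DecidableEq ι] [MeasurableSpace α]
    {μ : Measure α} {g : α → EuclideanSpace ℝ ι} (hg : ∀ k, MemLp (fun p => g p k) 2 μ) :
    MemLp g 2 μ := by
  have h1 : MemLp (fun p => ∑ k, EuclideanSpace.single k (g p k)) 2 μ :=
    memLp_finsetSum _ fun k _ =>
      ((ContinuousLinearMap.toSpanSingleton ℝ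
        (EuclideanSpace.single k (1 : ℝ))).comp_memLp' (hg k)).ae_eq
      (Filter.Eventually.of_forall fun p => by
        ext i; by_cases hi : i = k <;> simp [hi])
  refine h1.ae_eq (Filter.Eventually.of_forall fun p => ?_)
  ext i
  simp [Finset.sum_apply, Pi.single_apply]

theorem IsTestFunction.exists_bounded_depth (hζ : IsTestFunction U ζ) :
    ∃ l r : ℝ, ∀ p : Torus d × ℝ, ζ p ≠ 0 → p.2 ∈ Set.Icc l r := by
  obtain ⟨l, r, -, -, h⟩ := (hζ.mono (V := {p | -(⊤ : EReal) < (p.2 : EReal)})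
    fun p _ => by simp).exists_depth EReal.zero_lt_top
  exact ⟨l, r, fun p hp => h p (subset_closure hp)⟩

theorem isCompact_slab (d : ℕ) (l r : ℝ) :
    IsCompact (Set.univ ×ˢ Set.Icc l r : Set (Torus d × ℝ)) := isCompact_univ.prod isCompact_Icc

theorem isAddRightInvariant_volume (d : ℕ) :
    (volume : Measure (Torus d)).IsAddRightInvariant :=
  inferInstanceAs (Measure.pi fun _ : Fin d =>
    (volume : Measure (AddCircle (2 * Real.pi)))).IsAddRightInvariant

theorem isAddRightInvariant_volume_prod (d : ℕ) :
    (volume : Measure (Torus d × ℝ)).IsAddRightInvariant :=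
  have := isAddRightInvariant_volume d
  inferInstanceAs ((volume : Measure (Torus d)).prod
    (volume : Measure ℝ)).IsAddRightInvariant

/-- Integration by parts in a horizontal direction. -/
theorem integral_mul_torusPartial_some (hu : Continuous u) (j : Fin d)
    (hlip : ∀ l r : ℝ, ∃ C, ∀ p : Torus d × ℝ, p.2 ∈ Set.Icc l r → ∀ t : ℝ,
      |u (p + displacement (some j) t) - u p| ≤ C * |t|)
    (hder : ∀ᵐ p : Torus d × ℝ, HasDerivAt (fun t => u (p + displacement (some j) t)) (D p) 0)
    (hζ : IsTestFunction U ζ) :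
    ∫ p, u p * torusPartial (some j) ζ p = -∫ p, D p * ζ p := by
  obtain ⟨l, r, hlr⟩ := hζ.exists_bounded_depth
  obtain ⟨C, hC⟩ := hlip l r
  obtain ⟨C', hC'0, hC'⟩ := hζ.abs_sub_le (some j)
  have hK := isCompact_slab d l r
  have hKm : MeasurableSet (Set.univ ×ˢ Set.Icc l r : Set (Torus d × ℝ)) := hK.isClosed.measurableSet
  have hsnd : ∀ (p : Torus d × ℝ) (t : ℝ), (p + displacement (some j) t).2 = p.2 := fun p t => by
    simp [displacement]
  have hdisp : ∀ t : ℝ, Continuous fun p : Torus d × ℝ => p + displacement (some j) t :=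
    fun t => continuous_id.add continuous_const
  set s : ℕ → ℝ := fun n => 1 / ((n : ℝ) + 1)
  have hs0 : ∀ n, s n ≠ 0 := fun n => by positivity
  have hst : Filter.Tendsto s Filter.atTop (nhds 0) := tendsto_one_div_add_atTop_nhds_zero_nat
  have hs : Filter.Tendsto s Filter.atTop (nhdsWithin 0 {0}ᶜ) :=
    tendsto_nhdsWithin_iff.2 ⟨hst, Filter.Eventually.of_forall hs0⟩
  have hs' : Filter.Tendsto (fun n => -s n) Filter.atTop (nhdsWithin 0 {0}ᶜ) :=
    tendsto_nhdsWithin_iff.2 ⟨by simpa using hst.neg,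
      Filter.Eventually.of_forall fun n => neg_ne_zero.2 (hs0 n)⟩
  -- Integration by parts is the limit of its discrete version: the forward quotient of `ζ` against
  -- `u` equals a backward quotient of `u` against `ζ`. Both sides converge by dominated
  -- convergence.
  have lim1 : Filter.Tendsto (fun n => ∫ p, u p * ((s n)⁻¹ *
      (ζ (p + displacement (some j) (s n)) - ζ p))) Filter.atTop
      (nhds (∫ p, u p * torusPartial (some j) ζ p)) := by
    refine tendsto_integral_of_dominated_convergence
      ((Set.univ ×ˢ Set.Icc l r).indicator fun p => |u p| * C') (fun n => ?_) ?_ (fun n => ?_) ?_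
    · exact (hu.mul (continuous_const.mul
        ((hζ.continuous.comp (hdisp _)).sub hζ.continuous))).aestronglyMeasurable
    · rw [integrable_indicator_iff hKm]
      exact (hu.abs.mul continuous_const).continuousOn.integrableOn_compact hK
    · refine Filter.Eventually.of_forall fun p => ?_
      by_cases hp : p.2 ∈ Set.Icc l r
      · rw [Set.indicator_of_mem (by exact ⟨Set.mem_univ _, hp⟩), Real.norm_eq_abs, abs_mul,
          abs_mul, abs_inv]
        refine mul_le_mul_of_nonneg_left ?_ (abs_nonneg _)
        rw [inv_mul_le_iff₀ (abs_pos.2 (hs0 n))]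
        exact (hC' p _).trans_eq (mul_comm _ _)
      · have e1 : ζ p = 0 := by
          by_contra hc
          exact hp (hlr p hc)
        have e2 : ζ (p + displacement (some j) (s n)) = 0 := by
          by_contra hc
          have := hlr _ hc
          rw [hsnd] at this
          exact hp this
        rw [Set.indicator_of_notMem (fun hc => hp hc.2), e1, e2]
        simp
    · refine Filter.Eventually.of_forall fun p => ?_
      have h1 := (hζ.hasDerivAt (some j) p 0).tendsto_slope_zero.comp hs
      simp only [displacement_zero, add_zero, zero_add, smul_eq_mul] at h1
      exact h1.const_mul (u p)
  -- The step is `-s n` but the divisor is `s n`, which produces the minus sign in the limit `-D`.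
  have lim2 : Filter.Tendsto (fun n => ∫ p, ((s n)⁻¹ *
      (u (p + displacement (some j) (-s n)) - u p)) * ζ p) Filter.atTop
      (nhds (∫ p, -D p * ζ p)) := by
    refine tendsto_integral_of_dominated_convergence
      ((Set.univ ×ˢ Set.Icc l r).indicator fun p => C * |ζ p|) (fun n => ?_) ?_ (fun n => ?_) ?_
    · exact ((continuous_const.mul ((hu.comp (hdisp _)).sub hu)).mul
        hζ.continuous).aestronglyMeasurable
    · rw [integrable_indicator_iff hKm]
      exact (continuous_const.mul hζ.continuous.abs).continuousOn.integrableOn_compact hK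
    · refine Filter.Eventually.of_forall fun p => ?_
      by_cases hp : p.2 ∈ Set.Icc l r
      · rw [Set.indicator_of_mem (by exact ⟨Set.mem_univ _, hp⟩), Real.norm_eq_abs, abs_mul,
          abs_mul, abs_inv]
        refine mul_le_mul_of_nonneg_right ?_ (abs_nonneg _)
        rw [inv_mul_le_iff₀ (abs_pos.2 (hs0 n))]
        exact (hC p hp (-s n)).trans_eq (by rw [abs_neg]; exact mul_comm _ _)
      · have e1 : ζ p = 0 := by
          by_contra hc
          exact hp (hlr p hc)
        rw [Set.indicator_of_notMem (fun hc => hp hc.2), e1]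
        simp
    · filter_upwards [hder] with p hp
      have h1 := hp.tendsto_slope_zero.comp hs'
      simp only [displacement_zero, add_zero, zero_add, smul_eq_mul] at h1
      refine (h1.neg.congr fun n => ?_).mul_const (ζ p)
      simp [inv_neg]
  have heq : ∀ n, ∫ p, u p * ((s n)⁻¹ * (ζ (p + displacement (some j) (s n)) - ζ p)) =
      ∫ p, ((s n)⁻¹ * (u (p + displacement (some j) (-s n)) - u p)) * ζ p := by
    intro n
    have hi : ∀ v : Torus d × ℝ → ℝ, Continuous v → ∀ t, Integrable fun p =>
        v p * ζ (p + displacement (some j) t) := by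
      intro v hv t
      refine (hv.mul (hζ.continuous.comp (hdisp t))).integrable_of_hasCompactSupport ?_
      refine HasCompactSupport.intro hK fun p hp => ?_
      by_contra hc
      have := hlr _ (right_ne_zero_of_mul hc)
      rw [hsnd] at this
      exact hp ⟨Set.mem_univ _, this⟩
    have hi0 : ∀ v : Torus d × ℝ → ℝ, Continuous v → Integrable fun p => v p * ζ p := fun v hv => by
      simpa [displacement_zero] using hi v hv 0
    have htr : ∫ p, u p * ζ (p + displacement (some j) (s n)) =
        ∫ p, u (p + displacement (some j) (-s n)) * ζ p := by
      have := isAddRightInvariant_volume_prod d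
      rw [← integral_add_right_eq_self (fun p => u (p + displacement (some j) (-s n)) * ζ p)
        (displacement (some j) (s n))]
      simp only [add_assoc, ← displacement_add, add_neg_cancel, displacement_zero, add_zero]
    have e1 : ∀ p, u p * ((s n)⁻¹ * (ζ (p + displacement (some j) (s n)) - ζ p)) =
        (s n)⁻¹ * (u p * ζ (p + displacement (some j) (s n)) - u p * ζ p) := fun p => by ring
    have e2 : ∀ p, ((s n)⁻¹ * (u (p + displacement (some j) (-s n)) - u p)) * ζ p =
        (s n)⁻¹ * (u (p + displacement (some j) (-s n)) * ζ p - u p * ζ p) := fun p => by ring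
    simp only [e1, e2]
    rw [integral_const_mul, integral_const_mul, integral_sub (hi u hu _) (hi0 u hu),
      integral_sub (hi0 (fun p => u (p + displacement (some j) (-s n)))
        (hu.comp (hdisp _))) (hi0 u hu), htr]
  rw [← integral_neg]
  simp only [← neg_mul]
  simp only [heq] at lim1
  exact tendsto_nhds_unique lim1 lim2

/-- The trace formula below the graph of `η`. -/
theorem integral_fluidDomain_top_eq (hη : Continuous η) (hu : Continuous u) (hD : Measurable D)
    (hb : ∀ l r : ℝ, ∃ C, ∀ p : Torus d × ℝ, p.2 ∈ Set.Icc l r → |D p| ≤ C)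
    (hder : ∀ x, ∃ S : Set ℝ, S.Countable ∧
      ∀ y ∉ S, HasDerivAt (fun s => u (x, s)) (D (x, y)) y)
    (hζ : IsTestFunction U ζ) :
    ∫ p in fluidDomain ⊤ η, (u p * torusPartial none ζ p + D p * ζ p) =
      ∫ x : Torus d, u (x, η x) * ζ (x, η x) := by
  obtain ⟨l, r, hlr⟩ := hζ.exists_bounded_depth
  obtain ⟨l', r', hlr'⟩ := (hζ.torusPartial none).exists_bounded_depth
  obtain ⟨C, hC⟩ := hb l r
  have hΩ := measurableSet_fluidDomain (h := ⊤) hη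
  have hK := isCompact_slab d l r
  have i1 : Integrable fun p => u p * torusPartial none ζ p :=
    (hu.mul (hζ.torusPartial none).continuous).integrable_of_hasCompactSupport
      (hζ.torusPartial none).2.1.mul_left
  have i2 : Integrable fun p => D p * ζ p := by
    have : Integrable ((Set.univ ×ˢ Set.Icc l r).indicator fun p => C * |ζ p|) := by
      rw [integrable_indicator_iff hK.isClosed.measurableSet]
      exact (continuous_const.mul hζ.continuous.abs).continuousOn.integrableOn_compact hK
    refine this.mono' (hD.mul hζ.continuous.measurable).aestronglyMeasurable
      (Filter.Eventually.of_forall fun p => ?_)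
    by_cases hp : p.2 ∈ Set.Icc l r
    · rw [Set.indicator_of_mem (by exact ⟨Set.mem_univ _, hp⟩), Real.norm_eq_abs, abs_mul]
      exact mul_le_mul_of_nonneg_right (hC p hp) (abs_nonneg _)
    · have e1 : ζ p = 0 := by
        by_contra hc
        exact hp (hlr p hc)
      rw [Set.indicator_of_notMem (fun hc => hp hc.2), e1]
      simp
  have i3 := (i1.add i2).indicator hΩ
  rw [← integral_indicator hΩ]
  refine (integral_prod _ i3).trans ?_
  refine integral_congr_ae (Filter.Eventually.of_forall fun x => ?_)
  obtain ⟨S, hS, hd⟩ := hder x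
  -- A base point strictly below the supports of `ζ` and `∂_y ζ` and below the surface: the
  -- half-line reduces to `(a, η x)`, and the boundary term at `a` vanishes.
  set a := min (min l l') (η x) - 1 with ha
  have hal : a < l := by
    have := (min_le_left (min l l') (η x)).trans (min_le_left l l'); linarith
  have hal' : a < l' := by
    have := (min_le_left (min l l') (η x)).trans (min_le_right l l'); linarith
  have haη : a ≤ η x := by have := min_le_right (min l l') (η x); linarith
  have hz : ∀ y ≤ a, ζ (x, y) = 0 := fun y hy => by
    by_contra hc
    exact absurd (hlr _ hc).1 (not_le.2 (hy.trans_lt hal))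
  have hz' : ∀ y ≤ a, torusPartial none ζ (x, y) = 0 := fun y hy => by
    by_contra hc
    exact absurd (hlr' _ hc).1 (not_le.2 (hy.trans_lt hal'))
  have e1 : ∀ y, (fluidDomain ⊤ η).indicator
      ((fun p => u p * torusPartial none ζ p) + fun p => D p * ζ p) (x, y) =
      (Set.Ioo a (η x)).indicator (fun y => u (x, y) * torusPartial none ζ (x, y) +
        D (x, y) * ζ (x, y)) y := by
    intro y
    by_cases h1 : y < η x
    · rw [Set.indicator_of_mem (by exact ⟨by simp, h1⟩)]
      by_cases h2 : a < y
      · rw [Set.indicator_of_mem (by exact ⟨h2, h1⟩)]; rfl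
      · rw [Set.indicator_of_notMem (fun hc => h2 hc.1)]
        simp [hz y (not_lt.1 h2), hz' y (not_lt.1 h2)]
    · rw [Set.indicator_of_notMem (fun hc => h1 hc.2), Set.indicator_of_notMem (fun hc => h1 hc.2)]
  simp only [e1]
  have hzd : ∀ y : ℝ, HasDerivAt (fun s : ℝ => ζ (x, s)) (torusPartial none ζ (x, y)) y := by
    intro y
    have := hζ.hasDerivAt none (x, 0) y
    simpa [displacement] using this
  have hcx : Continuous fun y : ℝ => (x, y) := by fun_prop
  -- The integrand is the derivative of `u ζ` off a countable set, and `u ζ` is continuous, so the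
  -- fundamental theorem of calculus leaves the surface term.
  rw [integral_indicator measurableSet_Ioo, ← integral_Ioc_eq_integral_Ioo,
    ← intervalIntegral.integral_of_le haη,
    integral_eq_of_hasDerivAt_off_countable_of_le (fun y => u (x, y) * ζ (x, y))
      (fun y => u (x, y) * torusPartial none ζ (x, y) + D (x, y) * ζ (x, y)) haη hS
      ((hu.comp hcx).mul (hζ.continuous.comp hcx)).continuousOn
      (fun y hy => ((hd y hy.2).mul (hzd y)).congr_deriv (by ring)) ?_]
  · simp [hz a le_rfl]
  · refine IntervalIntegrable.add (Continuous.intervalIntegrable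
      ((hu.comp hcx).mul ((hζ.torusPartial none).continuous.comp hcx)) _ _) ?_
    obtain ⟨C2, hC2⟩ := hb a (η x)
    rw [intervalIntegrable_iff_integrableOn_Icc_of_le haη]
    have h3 : IntegrableOn (fun y => ζ (x, y)) (Set.Icc a (η x)) :=
      (hζ.integrable_section x).integrableOn
    refine h3.bdd_mul (c := C2) (hD.comp measurable_prodMk_left).aestronglyMeasurable ?_
    filter_upwards [ae_restrict_mem measurableSet_Icc] with y hy
    exact hC2 (x, y) hy

/-- Functions that are Lipschitz in the horizontal variables and piecewise differentiable in the
vertical variable have finite energy, as soon as their gradient is square integrable. -/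
theorem hasFiniteEnergy_of_lipschitz {g : Torus d × ℝ → EuclideanSpace ℝ (Option (Fin d))}
    (hη : Continuous η) (hu : Continuous u)
    (hlip : ∀ (j : Fin d) (l r : ℝ), ∃ C, ∀ p : Torus d × ℝ, p.2 ∈ Set.Icc l r → ∀ t : ℝ,
      |u (p + displacement (some j) t) - u p| ≤ C * |t|)
    (hder : ∀ j : Fin d, ∀ᵐ p : Torus d × ℝ,
      HasDerivAt (fun t => u (p + displacement (some j) t)) (g p (some j)) 0)
    (hD : Measurable fun p => g p none)
    (hb : ∀ l r : ℝ, ∃ C, ∀ p : Torus d × ℝ, p.2 ∈ Set.Icc l r → |g p none| ≤ C)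
    (hder' : ∀ x, ∃ S : Set ℝ, S.Countable ∧
      ∀ y ∉ S, HasDerivAt (fun s => u (x, s)) (g (x, y) none) y)
    (hg : MemLp g 2 (volume.restrict (fluidDomain ⊤ η))) :
    HasFiniteEnergy ⊤ η u g ∧ HasSurfaceTrace ⊤ η u g fun x => u (x, η x) := by
  obtain ⟨M, hM⟩ := exists_forall_le hη
  have hul : ∀ R : ℝ, MemLp u 2 (volume.restrict (fluidDomain ⊤ η ∩ {p | -R < p.2})) := by
    intro R
    have hK := isCompact_slab d (-R) M
    have hfin : IsFiniteMeasure (volume.restrict (fluidDomain ⊤ η ∩ {p | -R < p.2})) :=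
      ⟨by simpa using measure_slab_lt_top hη R⟩
    obtain ⟨C, hC⟩ := hK.exists_bound_of_continuousOn hu.continuousOn
    refine MemLp.of_bound hu.aestronglyMeasurable C ?_
    filter_upwards [ae_restrict_mem (measurableSet_slab hη R)] with p hp
    exact hC p ⟨Set.mem_univ _, hp.2.le, hp.1.2.le.trans (hM _)⟩
  have htr : HasSurfaceTrace ⊤ η u g fun x => u (x, η x) := by
    have hc : Continuous fun x => u (x, η x) := hu.comp (by fun_prop)
    exact ⟨hc.memLp_of_hasCompactSupport (HasCompactSupport.of_compactSpace _),
      fun ζ hζ => integral_fluidDomain_top_eq hη hu hD hb hder' hζ⟩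
  refine ⟨⟨hul, hg, fun k ζ hζ => ?_⟩, htr⟩
  cases k with
  | none => exact htr.weak_deriv_none EReal.zero_lt_top hη hul (hg.coord none) ζ hζ
  | some j =>
    rw [setIntegral_eq_integral_of_forall_compl_eq_zero fun p hp => ?_,
      setIntegral_eq_integral_of_forall_compl_eq_zero fun p hp => ?_]
    · exact integral_mul_torusPartial_some hu j (hlip j) (hder j) hζ
    · rw [image_eq_zero_of_notMem_tsupport fun hc => hp (hζ.2.2 hc), mul_zero]
    · rw [IsTestFunction.torusPartial_eq_zero _ fun hc => hp (hζ.2.2 hc), mul_zero]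

end Lipschitz

/-! ### The truncated height as an extension of `η` -/

section Truncation

variable {d : ℕ} {η : Torus d → ℝ}

theorem volume_truncated_fluidDomain (hη : Continuous η) {c : ℝ} (hc : ∀ x, c ≤ η x) :
    volume (fluidDomain ⊤ η ∩ {p : Torus d × ℝ | c < p.2}) =
      ENNReal.ofReal (∫ x, (η x - c)) := by
  have h1 := volume_regionBetween_eq_integral (μ := (volume : Measure (Torus d)))
    (f := fun _ => c) (g := η) (s := Set.univ) (integrable_const c).integrableOn
    (hη.integrable_of_hasCompactSupport (HasCompactSupport.of_compactSpace _)).integrableOn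
    MeasurableSet.univ fun x _ => hc x
  simp only [Measure.restrict_univ, Pi.sub_apply] at h1
  rw [← h1]
  congr 1
  ext p
  simp [fluidDomain, regionBetween, and_comm]

/-- The truncated vertical coordinate `max y c` is an extension of `η` with energy `∫ (η - c)`. -/
theorem hasFiniteEnergy_max (hη : Continuous η) {c : ℝ} (hc : ∀ x, c ≤ η x) :
    ∃ g : Torus d × ℝ → EuclideanSpace ℝ (Option (Fin d)),
      HasFiniteEnergy ⊤ η (fun p => max p.2 c) g ∧
      HasSurfaceTrace ⊤ η (fun p => max p.2 c) g η ∧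
      ∫ p in fluidDomain ⊤ η, ‖g p‖ ^ 2 = ∫ x, (η x - c) := by
  set A : Set (Torus d × ℝ) := {p | c < p.2} with hA
  have hAm : MeasurableSet A := measurableSet_lt measurable_const measurable_snd
  set g : Torus d × ℝ → EuclideanSpace ℝ (Option (Fin d)) :=
    A.indicator fun _ => EuclideanSpace.single none 1 with hg
  have hgn : ∀ p, g p none = A.indicator (fun _ => 1) p := fun p => by
    by_cases hp : p ∈ A <;> simp [hg, hp]
  have hgs : ∀ p j, g p (some j) = 0 := fun p j => by
    by_cases hp : p ∈ A <;> simp [hg, hp]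
  have hvol := volume_truncated_fluidDomain hη hc
  have hΩ := measurableSet_fluidDomain (h := ⊤) hη
  have hgL : MemLp g 2 (volume.restrict (fluidDomain ⊤ η)) := by
    refine memLp_indicator_const 2 hAm _ (Or.inr ?_)
    rw [Measure.restrict_apply hAm, Set.inter_comm, hvol]
    exact ENNReal.ofReal_ne_top
  obtain ⟨h1, h2⟩ := hasFiniteEnergy_of_lipschitz (u := fun p : Torus d × ℝ => max p.2 c) (g := g)
    hη (by fun_prop) (fun j l r => ⟨0, fun p _ t => by simp [displacement]⟩)
    (fun j => Filter.Eventually.of_forall fun p => by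
      rw [hgs]
      simpa [displacement] using hasDerivAt_const (0 : ℝ) (max p.2 c))
    (by simp only [hgn]; exact measurable_const.indicator hAm)
    (fun l r => ⟨1, fun p _ => by
      rw [hgn]; by_cases hp : p ∈ A <;> simp [hp]⟩)
    -- The kink at `y = c` is the only exceptional height.
    (fun x => ⟨{c}, Set.countable_singleton c, fun y hy => by
      rw [hgn]
      rcases lt_or_gt_of_ne (Set.mem_singleton_iff.not.1 hy) with h1 | h1
      · rw [Set.indicator_of_notMem (by simpa [hA] using h1.le)]
        refine (hasDerivAt_const y c).congr_of_eventuallyEq ?_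
        filter_upwards [eventually_lt_nhds h1] with s hs
        exact max_eq_right hs.le
      · rw [Set.indicator_of_mem (by simpa [hA] using h1)]
        refine (hasDerivAt_id y).congr_of_eventuallyEq ?_
        filter_upwards [eventually_gt_nhds h1] with s hs
        exact max_eq_left hs.le⟩)
    hgL
  refine ⟨g, h1, by simpa only [max_eq_left (hc _)] using h2, ?_⟩
  have e : ∀ p, ‖g p‖ ^ 2 = A.indicator (fun _ => (1 : ℝ)) p := fun p => by
    by_cases hp : p ∈ A <;> simp [hg, hp]
  simp only [e]
  rw [integral_indicator_const _ hAm, smul_eq_mul, mul_one, measureReal_restrict_apply hAm,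
    Set.inter_comm, measureReal_def, hvol, ENNReal.toReal_ofReal]
  exact integral_nonneg fun x => sub_nonneg.2 (hc x)

end Truncation

/-! ### Fourier series on the torus in `L²` -/

section TorusFourier

variable {d : ℕ}

/-- The character `e^{i x·ξ}` of the torus. -/
noncomputable def torusChar (ξ : Fin d → ℤ) : C(Torus d, ℂ) where
  toFun x := ∏ j, fourier (ξ j) (x j)
  continuous_toFun := by fun_prop

theorem torusChar_apply (ξ : Fin d → ℤ) (x : Torus d) :
    torusChar ξ x = ∏ j, (fourier (ξ j) (x j) : ℂ) := rfl

theorem norm_torusChar (ξ : Fin d → ℤ) (x : Torus d) : ‖torusChar ξ x‖ = 1 := by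
  rw [torusChar_apply, norm_prod]
  exact Finset.prod_eq_one fun j _ => by rw [fourier_apply]; exact Circle.norm_coe _

theorem torusChar_neg (ξ : Fin d → ℤ) (x : Torus d) :
    torusChar (-ξ) x = (starRingEnd ℂ) (torusChar ξ x) := by
  simp only [torusChar_apply, Pi.neg_apply, fourier_neg, map_prod]

theorem torusChar_add (ξ ξ' : Fin d → ℤ) (x : Torus d) :
    torusChar (ξ + ξ') x = torusChar ξ x * torusChar ξ' x := by
  simp only [torusChar_apply, Pi.add_apply, fourier_add, ← Finset.prod_mul_distrib]

theorem torusChar_zero (x : Torus d) : torusChar 0 x = 1 := by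
  simp [torusChar_apply]

theorem torusChar_add_single (ξ : Fin d → ℤ) (x : Torus d) (j : Fin d) (t : ℝ) :
    torusChar ξ (x + Pi.single j (t : AddCircle (2 * Real.pi))) =
      torusChar ξ x * Complex.exp ((ξ j * t : ℝ) * Complex.I) := by
  have h1 : ∀ i, (fourier (ξ i)
      ((x + Pi.single j (t : AddCircle (2 * Real.pi)) : Torus d) i) : ℂ) =
      fourier (ξ i) (x i) * if i = j then Complex.exp ((ξ j * t : ℝ) * Complex.I) else 1 := by
    intro i
    by_cases hi : i = j
    · subst hi
      rw [if_pos rfl, Pi.add_apply, Pi.single_eq_same, fourier_apply, fourier_apply, smul_add,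
        AddCircle.toCircle_add, Circle.coe_mul]
      congr 1
      rw [← fourier_apply, fourier_coe_apply]
      congr 1
      have : (Real.pi : ℂ) ≠ 0 := by exact_mod_cast Real.pi_ne_zero
      push_cast
      field_simp
    · rw [if_neg hi, Pi.add_apply, Pi.single_eq_of_ne hi, add_zero, mul_one]
  rw [torusChar_apply, Finset.prod_congr rfl fun i _ => h1 i, Finset.prod_mul_distrib,
    Finset.prod_ite_eq' Finset.univ j, if_pos (Finset.mem_univ j), torusChar_apply]

theorem integral_fourier_eq_zero {n : ℤ} (hn : n ≠ 0) :
    ∫ x : AddCircle (2 * Real.pi), (fourier n x : ℂ) = 0 := by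
  rw [← AddCircle.intervalIntegral_preimage (2 * Real.pi) 0]
  have h1 : ∀ x : ℝ, (fourier n (x : AddCircle (2 * Real.pi)) : ℂ) =
      Complex.exp ((n * Complex.I) * x) := fun x => by
    rw [fourier_coe_apply]
    congr 1
    have : (Real.pi : ℂ) ≠ 0 := by exact_mod_cast Real.pi_ne_zero
    push_cast
    field_simp
  simp only [h1]
  rw [integral_exp_mul_complex (by simp [hn])]
  have h2 : Complex.exp (n * Complex.I * ((0 + 2 * Real.pi : ℝ) : ℂ)) = 1 := by
    rw [← Complex.exp_int_mul_two_pi_mul_I n]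
    congr 1
    push_cast
    ring
  rw [h2]
  simp

theorem volume_real_torus (d : ℕ) :
    volume.real (Set.univ : Set (Torus d)) = (2 * Real.pi) ^ d := by
  rw [measureReal_def, volume_pi, Measure.pi_univ]
  simp [AddCircle.measure_univ, ENNReal.toReal_ofReal Real.pi_nonneg]

theorem integral_torusChar (ξ : Fin d → ℤ) :
    ∫ x : Torus d, torusChar ξ x = if ξ = 0 then (((2 * Real.pi) ^ d : ℝ) : ℂ) else 0 := by
  split_ifs with h
  · subst h
    simp only [torusChar_zero]
    rw [integral_const, volume_real_torus]
    simp
  · obtain ⟨i, hi⟩ := Function.ne_iff.mp h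
    simp only [torusChar_apply]
    rw [MeasureTheory.integral_fintype_prod_volume_eq_prod
      (fun i (x : AddCircle (2 * Real.pi)) => (fourier (ξ i) x : ℂ))]
    exact Finset.prod_eq_zero (Finset.mem_univ i) (integral_fourier_eq_zero hi)

/-- The star subalgebra generated by the characters. -/
noncomputable def torusCharSubalgebra (d : ℕ) : StarSubalgebra ℂ C(Torus d, ℂ) where
  toSubalgebra := Algebra.adjoin ℂ (Set.range torusChar)
  star_mem' := by
    change Algebra.adjoin ℂ (Set.range torusChar) ≤ star (Algebra.adjoin ℂ (Set.range torusChar))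
    refine Algebra.adjoin_le ?_
    rintro _ ⟨ξ, rfl⟩
    refine Algebra.subset_adjoin ⟨-ξ, ?_⟩
    ext1 x
    simp only [torusChar_neg, starRingEnd_apply, ContinuousMap.star_apply]

/-- The characters are closed under products and contain `1`, so generating an algebra adds nothing
to their linear span. -/
theorem torusCharSubalgebra_coe (d : ℕ) :
    Subalgebra.toSubmodule (torusCharSubalgebra d).toSubalgebra =
      Submodule.span ℂ (Set.range torusChar) := by
  apply Algebra.adjoin_eq_span_of_subset
  refine .trans (fun x => Submonoid.closure_induction (fun _ => id) ⟨0, ?_⟩ ?_)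
    Submodule.subset_span
  · ext z
    simp [torusChar_zero]
  · rintro _ _ _ _ ⟨m, rfl⟩ ⟨n, rfl⟩
    refine ⟨m + n, ?_⟩
    ext z
    simp [torusChar_add]

/-- Points that differ in coordinate `i` are separated by the character with frequency the `i`-th
unit vector, because `AddCircle.toCircle` is injective. -/
theorem torusCharSubalgebra_separatesPoints (d : ℕ) :
    (torusCharSubalgebra d).SeparatesPoints := by
  intro x y hxy
  rw [Ne, funext_iff, not_forall] at hxy
  obtain ⟨i, hi⟩ := hxy
  have hs : ∀ z : Torus d, torusChar (Pi.single i 1) z = AddCircle.toCircle (z i) := by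
    intro z
    rw [torusChar_apply, Finset.prod_eq_single i (fun j _ hj => by simp [hj]) (by simp)]
    simp
  refine ⟨_, ⟨torusChar (Pi.single i 1), Algebra.subset_adjoin ⟨Pi.single i 1, rfl⟩, rfl⟩, ?_⟩
  dsimp only
  rw [hs, hs]
  contrapose hi
  exact AddCircle.injective_toCircle Real.two_pi_pos.ne' (Circle.ext hi)

/-- The Stone–Weierstrass theorem; `L²` density then follows from that of continuous functions. -/
theorem span_torusChar_closure_eq_top (d : ℕ) :
    (Submodule.span ℂ (Set.range (torusChar (d := d)))).topologicalClosure = ⊤ := by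
  rw [← torusCharSubalgebra_coe]
  exact congr_arg (Subalgebra.toSubmodule <| StarSubalgebra.toSubalgebra ·)
    (ContinuousMap.starSubalgebra_topologicalClosure_eq_top_of_separatesPoints _
      (torusCharSubalgebra_separatesPoints d))

/-- The `L²` norm of the characters. -/
noncomputable def torusCharNorm (d : ℕ) : ℝ := Real.sqrt ((2 * Real.pi) ^ d)

theorem torusCharNorm_pos (d : ℕ) : 0 < torusCharNorm d :=
  Real.sqrt_pos.2 (pow_pos Real.two_pi_pos d)

theorem torusCharNorm_sq (d : ℕ) : torusCharNorm d ^ 2 = (2 * Real.pi) ^ d :=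
  Real.sq_sqrt (pow_pos Real.two_pi_pos d).le

/-- The normalized characters, as elements of `L²`. -/
noncomputable def torusCharLp (ξ : Fin d → ℤ) : Lp ℂ 2 (volume : Measure (Torus d)) :=
  ((torusCharNorm d : ℂ))⁻¹ • ContinuousMap.toLp (E := ℂ) 2 volume ℂ (torusChar ξ)

theorem orthonormal_torusCharLp : Orthonormal ℂ (torusCharLp (d := d)) := by
  rw [orthonormal_iff_ite]
  intro m n
  have h0 : (torusCharNorm d : ℂ) ≠ 0 := by exact_mod_cast (torusCharNorm_pos d).ne'
  rw [torusCharLp, torusCharLp, inner_smul_left, inner_smul_right, ContinuousMap.inner_toLp]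
  have h1 : ∀ x, torusChar n x * (starRingEnd ℂ) (torusChar m x) = torusChar (n - m) x :=
    fun x => by rw [sub_eq_add_neg, torusChar_add, torusChar_neg]
  simp only [h1, integral_torusChar, sub_eq_zero, eq_comm (a := n)]
  split_ifs with h
  · rw [← torusCharNorm_sq, map_inv₀, Complex.conj_ofReal]
    push_cast
    field_simp
  · simp

theorem span_torusCharLp_closure_eq_top :
    (Submodule.span ℂ (Set.range (torusCharLp (d := d)))).topologicalClosure = ⊤ := by
  have h0 : (torusCharNorm d : ℂ) ≠ 0 := by exact_mod_cast (torusCharNorm_pos d).ne'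
  have h1 : (Submodule.span ℂ (Set.range fun ξ : Fin d → ℤ =>
      ContinuousMap.toLp (E := ℂ) 2 volume ℂ (torusChar ξ))).topologicalClosure = ⊤ := by
    simpa only [Submodule.map_span, ContinuousLinearMap.coe_coe, ← Set.range_comp,
      Function.comp_def] using
      (ContinuousMap.toLp_denseRange ℂ (volume : Measure (Torus d)) ℂ
        (by simp : (2 : ENNReal) ≠ ⊤)).topologicalClosure_map_submodule
        (span_torusChar_closure_eq_top d)
  rw [eq_top_iff, ← h1]
  refine Submodule.topologicalClosure_mono (Submodule.span_le.2 ?_)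
  rintro _ ⟨ξ, rfl⟩
  have : ContinuousMap.toLp (E := ℂ) 2 volume ℂ (torusChar ξ) =
      (torusCharNorm d : ℂ) • torusCharLp ξ := by
    rw [torusCharLp, smul_inv_smul₀ h0]
  simp only [this]
  exact Submodule.smul_mem _ _ (Submodule.subset_span ⟨ξ, rfl⟩)

/-- The Fourier series of a square integrable function converges to it in `L²`. -/
theorem hasSum_torusFourier {f : Torus d → ℝ} (hf : MemLp (fun x => (f x : ℂ)) 2 volume)
    (hchar : ∀ ξ : Fin d → ℤ, MemLp (fun x => torusFourierCoeff f ξ * torusChar ξ x) 2 volume) :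
    HasSum (fun ξ : Fin d → ℤ => (hchar ξ).toLp _) (hf.toLp _) := by
  have h0 : (torusCharNorm d : ℂ) ≠ 0 := by exact_mod_cast (torusCharNorm_pos d).ne'
  have key := (HilbertBasis.mk orthonormal_torusCharLp
    span_torusCharLp_closure_eq_top.ge).hasSum_repr (hf.toLp _)
  refine key.congr_fun fun ξ => ?_
  rw [HilbertBasis.repr_apply_apply, HilbertBasis.coe_mk, torusCharLp, inner_smul_left, smul_smul]
  have h1 : inner ℂ (ContinuousMap.toLp (E := ℂ) 2 volume ℂ (torusChar ξ)) (hf.toLp _) =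
      ∫ x : Torus d, torusChar (-ξ) x * (f x : ℂ) := by
    rw [L2.inner_def]
    refine integral_congr_ae ?_
    filter_upwards [hf.coeFn_toLp, ContinuousMap.coeFn_toLp (p := 2) (𝕜 := ℂ) volume
      (torusChar ξ)] with x hx hx'
    rw [hx, hx', torusChar_neg, RCLike.inner_apply, mul_comm]
  -- One factor `(2π)^{-d/2}` comes from the coefficient and one from the normalized basis vector;
  -- together they are the `(2π)^{-d}` of `torusFourierCoeff`.
  have h2 : (starRingEnd ℂ) ((torusCharNorm d : ℂ)⁻¹) * inner ℂ (ContinuousMap.toLp (E := ℂ) 2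
      volume ℂ (torusChar ξ)) (hf.toLp _) * (torusCharNorm d : ℂ)⁻¹ = torusFourierCoeff f ξ := by
    rw [h1, torusFourierCoeff, map_inv₀, Complex.conj_ofReal]
    have h3 : (((2 * Real.pi : ℝ) : ℂ)⁻¹) ^ d = (torusCharNorm d : ℂ)⁻¹ * (torusCharNorm d : ℂ)⁻¹ := by
      rw [← mul_inv, ← sq, ← Complex.ofReal_pow, torusCharNorm_sq, Complex.ofReal_pow, inv_pow]
    rw [h3]
    simp only [torusChar_apply, Pi.neg_apply]
    ring
  rw [h2]
  refine Lp.ext ?_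
  filter_upwards [(hchar ξ).coeFn_toLp, Lp.coeFn_smul (torusFourierCoeff f ξ)
    (ContinuousMap.toLp (E := ℂ) 2 volume ℂ (torusChar ξ)),
    ContinuousMap.coeFn_toLp (p := 2) (𝕜 := ℂ) volume (torusChar ξ)] with x h1 h2 h3
  rw [h1, h2, Pi.smul_apply, h3, smul_eq_mul]

end TorusFourier

/-! ### Partial derivatives of a Lipschitz function on the torus -/

section Rademacher

variable {d : ℕ} {η : Torus d → ℝ} {K : NNReal}

/-- The partial derivative of a function on the torus. -/
noncomputable def horizontalDeriv (η : Torus d → ℝ) (j : Fin d) (x : Torus d) : ℝ :=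
  deriv (fun t : ℝ => η (x + Pi.single j (t : AddCircle (2 * Real.pi)))) 0

theorem LipschitzWith.comp_add_single (hη : LipschitzWith K η) (x : Torus d) (j : Fin d) :
    LipschitzWith K fun t : ℝ => η (x + Pi.single j (t : AddCircle (2 * Real.pi))) := by
  have h1 : LipschitzWith 1 fun t : ℝ =>
      (x + Pi.single j (t : AddCircle (2 * Real.pi)) : Torus d) := by
    refine LipschitzWith.mk_one fun s t => ?_
    rw [dist_add_left]
    refine (dist_pi_le_iff dist_nonneg).2 fun i => ?_
    by_cases hi : i = j
    · subst hi
      rw [Pi.single_eq_same, Pi.single_eq_same, dist_eq_norm, dist_eq_norm, ← AddCircle.coe_sub]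
      exact QuotientAddGroup.norm_mk_le_norm
    · rw [Pi.single_eq_of_ne hi, Pi.single_eq_of_ne hi, dist_self]
      exact dist_nonneg
  simpa using! hη.comp h1

theorem abs_horizontalDeriv_le (hη : LipschitzWith K η) (j : Fin d) (x : Torus d) :
    |horizontalDeriv η j x| ≤ K := norm_deriv_le_of_lipschitz (hη.comp_add_single x j)

theorem continuous_uncurry_add_single (hη : Continuous η) (j : Fin d) :
    Continuous (Function.uncurry fun (x : Torus d) (t : ℝ) =>
      η (x + Pi.single j (t : AddCircle (2 * Real.pi)))) :=
  hη.comp (continuous_fst.add ((continuous_single j).comp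
    ((AddCircle.continuous_mk' _).comp continuous_snd)))

theorem measurable_horizontalDeriv (hη : Continuous η) (j : Fin d) :
    Measurable (horizontalDeriv η j) :=
  (measurable_deriv_with_param (continuous_uncurry_add_single hη j)).comp
    (measurable_id.prodMk measurable_const)

/-- On each coordinate line the function is Lipschitz, hence differentiable at almost every `t`. By
Fubini's theorem some fixed `t` works for almost every `x`, and translation invariance of the
measure moves that `t` to `0`. -/
theorem ae_hasDerivAt_horizontalDeriv (hη : LipschitzWith K η) (j : Fin d) :
    ∀ᵐ x : Torus d, HasDerivAt (fun t : ℝ => η (x + Pi.single j (t : AddCircle (2 * Real.pi))))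
      (horizontalDeriv η j x) 0 := by
  have hm := measurableSet_of_differentiableAt_with_param ℝ
    (continuous_uncurry_add_single hη.continuous j)
  have h1 : ∀ᵐ q : Torus d × ℝ, DifferentiableAt ℝ
      (fun t : ℝ => η (q.1 + Pi.single j (t : AddCircle (2 * Real.pi)))) q.2 :=
    (Measure.ae_prod_iff_ae_ae hm).2
      (Filter.Eventually.of_forall fun x => (hη.comp_add_single x j).ae_differentiableAt_real)
  have h2 : ∀ᵐ t : ℝ, ∀ᵐ x : Torus d, DifferentiableAt ℝ
      (fun t : ℝ => η (x + Pi.single j (t : AddCircle (2 * Real.pi)))) t :=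
    Measure.ae_ae_of_ae_prod (Measure.measurePreserving_swap.quasiMeasurePreserving.ae h1)
  obtain ⟨t, ht⟩ := h2.exists
  have := isAddRightInvariant_volume d
  have h3 := (measurePreserving_sub_right (volume : Measure (Torus d))
    (Pi.single j (t : AddCircle (2 * Real.pi)))).quasiMeasurePreserving.ae ht
  filter_upwards [h3] with x hx
  refine DifferentiableAt.hasDerivAt ?_
  have h4 : (fun s : ℝ => η (x + Pi.single j (s : AddCircle (2 * Real.pi)))) =
      (fun s : ℝ => η (x - Pi.single j (t : AddCircle (2 * Real.pi)) +
        Pi.single j (s : AddCircle (2 * Real.pi)))) ∘ fun s : ℝ => t + s := by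
    ext s
    simp only [Function.comp_apply, AddCircle.coe_add, Pi.single_add]
    congr 1
    abel
  rw [h4]
  refine DifferentiableAt.comp 0 ?_ (by fun_prop)
  simpa using hx

end Rademacher

/-! ### Extension of `H^{1/2}` data by orthogonal exponential modes -/

section Modes

variable {d : ℕ} {η : Torus d → ℝ}

/-- The weight `(1 + |ξ|²)^{1/2}`. -/
noncomputable def bracket (ξ : Fin d → ℤ) : ℝ := Real.sqrt (1 + ∑ j, (ξ j : ℝ) ^ 2)

theorem one_le_bracket (ξ : Fin d → ℤ) : 1 ≤ bracket ξ := by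
  rw [bracket, Real.one_le_sqrt]
  linarith [Finset.sum_nonneg fun j (_ : j ∈ Finset.univ) => sq_nonneg (ξ j : ℝ)]

theorem bracket_pos (ξ : Fin d → ℤ) : 0 < bracket ξ := one_pos.trans_le (one_le_bracket ξ)

theorem abs_le_bracket (ξ : Fin d → ℤ) (j : Fin d) : |(ξ j : ℝ)| ≤ bracket ξ := by
  refine Real.abs_le_sqrt ?_
  have := Finset.single_le_sum (fun j _ => sq_nonneg (ξ j : ℝ)) (Finset.mem_univ j)
  linarith

theorem indicator_fluidDomain_top {E : Type*} [Zero E] (F : Torus d × ℝ → E) (x : Torus d) (y : ℝ) :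
    (fluidDomain ⊤ η).indicator F (x, y) = (Set.Iio (η x)).indicator (fun y => F (x, y)) y := by
  by_cases h : y < η x
  · rw [Set.indicator_of_mem (by exact ⟨by simp, h⟩), Set.indicator_of_mem (by exact h)]
  · rw [Set.indicator_of_notMem (fun hc => h hc.2), Set.indicator_of_notMem (by exact h)]

theorem integrableOn_exp_Iio {c : ℝ} (hc : 0 < c) (b : ℝ) :
    IntegrableOn (fun y : ℝ => Real.exp (c * (y - b))) (Set.Iio b) := by
  have h1 : ∀ y : ℝ, Real.exp (c * (y - b)) = Real.exp (-(c * b)) * Real.exp (c * y) := fun y => by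
    rw [← Real.exp_add]; ring_nf
  simp only [h1]
  exact ((integrableOn_exp_mul_Iic hc b).mono_set Set.Iio_subset_Iic_self).const_mul _

theorem integral_exp_Iio {c : ℝ} (hc : 0 < c) (b : ℝ) :
    ∫ y in Set.Iio b, Real.exp (c * (y - b)) = c⁻¹ := by
  have h1 : ∀ y : ℝ, Real.exp (c * (y - b)) = Real.exp (-(c * b)) * Real.exp (c * y) := fun y => by
    rw [← Real.exp_add]; ring_nf
  simp only [h1]
  rw [integral_const_mul, ← integral_Iic_eq_integral_Iio, integral_exp_mul_Iic hc, ← mul_div_assoc,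
    ← Real.exp_add]
  simp

theorem integrableOn_exp_fluidDomain (hη : Continuous η) {c : ℝ} (hc : 0 < c) :
    IntegrableOn (fun p : Torus d × ℝ => Real.exp (c * (p.2 - η p.1))) (fluidDomain ⊤ η) := by
  have hΩ := measurableSet_fluidDomain (h := ⊤) hη
  have hcont : Continuous fun p : Torus d × ℝ => Real.exp (c * (p.2 - η p.1)) := by fun_prop
  rw [← integrable_indicator_iff hΩ, Measure.volume_eq_prod,
    integrable_prod_iff (hcont.measurable.indicator hΩ).aestronglyMeasurable]
  constructor
  · refine Filter.Eventually.of_forall fun x => ?_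
    simp only [indicator_fluidDomain_top]
    rw [integrable_indicator_iff measurableSet_Iio]
    exact integrableOn_exp_Iio hc (η x)
  · have : ∀ x : Torus d, ∫ y, ‖(fluidDomain ⊤ η).indicator
        (fun p : Torus d × ℝ => Real.exp (c * (p.2 - η p.1))) (x, y)‖ = c⁻¹ := fun x => by
      simp only [indicator_fluidDomain_top, norm_indicator_eq_indicator_norm, Real.norm_eq_abs,
        Real.abs_exp]
      rw [integral_indicator measurableSet_Iio, integral_exp_Iio hc]
    simp only [this]
    exact integrable_const _

/-- The integral along each vertical line is `c⁻¹`, independently of `η(x)`: the shear `y ↦ y -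
η(x)` disappears, which is why the modes stay orthogonal under an arbitrary surface. -/
theorem integral_mul_exp_fluidDomain (hη : Continuous η) {c : ℝ} (hc : 0 < c) (b : C(Torus d, ℂ)) :
    ∫ p in fluidDomain ⊤ η, b p.1 * (Real.exp (c * (p.2 - η p.1)) : ℂ) = (∫ x, b x) * (c : ℂ)⁻¹ := by
  have hΩ := measurableSet_fluidDomain (h := ⊤) hη
  have hb : Continuous fun p : Torus d × ℝ => b p.1 := by fun_prop
  have hi : IntegrableOn (fun p : Torus d × ℝ => b p.1 * (Real.exp (c * (p.2 - η p.1)) : ℂ))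
      (fluidDomain ⊤ η) :=
    (integrableOn_exp_fluidDomain hη hc).ofReal.bdd_mul hb.aestronglyMeasurable
      (Filter.Eventually.of_forall fun p => b.norm_coe_le_norm p.1)
  rw [← integral_indicator hΩ, Measure.volume_eq_prod, integral_prod _
    (by exact (integrable_indicator_iff hΩ).2 hi), ← integral_mul_const]
  refine integral_congr_ae (Filter.Eventually.of_forall fun x => ?_)
  simp only [indicator_fluidDomain_top]
  rw [integral_indicator measurableSet_Iio, integral_const_mul, integral_complex_ofReal,
    integral_exp_Iio hc, Complex.ofReal_inv]

/-- The exponential `e^{i x·ξ + ⟨ξ⟩ (y - η(x))}`, which extends the character `e^{i x·ξ}`. -/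
noncomputable def surfaceMode (η : Torus d → ℝ) (ξ : Fin d → ℤ) (p : Torus d × ℝ) : ℂ :=
  torusChar ξ p.1 * (Real.exp (bracket ξ * (p.2 - η p.1)) : ℂ)

theorem continuous_surfaceMode (hη : Continuous η) (ξ : Fin d → ℤ) :
    Continuous (surfaceMode η ξ) := by
  unfold surfaceMode
  fun_prop

theorem norm_surfaceMode (ξ : Fin d → ℤ) (p : Torus d × ℝ) :
    ‖surfaceMode η ξ p‖ = Real.exp (bracket ξ * (p.2 - η p.1)) := by
  rw [surfaceMode, norm_mul, norm_torusChar, one_mul, Complex.norm_real, Real.norm_eq_abs,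
    Real.abs_exp]

theorem memLp_surfaceMode (hη : Continuous η) (ξ : Fin d → ℤ) :
    MemLp (surfaceMode η ξ) 2 (volume.restrict (fluidDomain ⊤ η)) := by
  rw [memLp_two_iff_integrable_sq_norm (continuous_surfaceMode hη ξ).aestronglyMeasurable]
  have h1 : ∀ p, ‖surfaceMode η ξ p‖ ^ 2 = Real.exp (2 * bracket ξ * (p.2 - η p.1)) := fun p => by
    rw [norm_surfaceMode, ← Real.exp_nat_mul]
    congr 1
    push_cast
    ring
  simp only [h1]
  exact integrableOn_exp_fluidDomain hη (by linarith [bracket_pos ξ])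

theorem inner_surfaceMode (hη : Continuous η) (ξ ξ' : Fin d → ℤ) :
    inner ℂ ((memLp_surfaceMode hη ξ).toLp _) ((memLp_surfaceMode hη ξ').toLp _) =
      if ξ = ξ' then (((2 * Real.pi) ^ d / (2 * bracket ξ) : ℝ) : ℂ) else 0 := by
  have h1 : inner ℂ ((memLp_surfaceMode hη ξ).toLp _) ((memLp_surfaceMode hη ξ').toLp _) =
      ∫ p in fluidDomain ⊤ η, torusChar (ξ' - ξ) p.1 *
        (Real.exp ((bracket ξ + bracket ξ') * (p.2 - η p.1)) : ℂ) := by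
    rw [L2.inner_def]
    refine integral_congr_ae ?_
    filter_upwards [(memLp_surfaceMode hη ξ).coeFn_toLp, (memLp_surfaceMode hη ξ').coeFn_toLp]
      with p hp hp'
    rw [hp, hp', RCLike.inner_apply, surfaceMode, surfaceMode, map_mul, Complex.conj_ofReal,
      sub_eq_add_neg ξ' ξ, torusChar_add, torusChar_neg, add_mul, Real.exp_add]
    push_cast
    ring
  rw [h1, integral_mul_exp_fluidDomain hη (add_pos (bracket_pos ξ) (bracket_pos ξ')),
    integral_torusChar]
  by_cases h : ξ = ξ'
  · subst h
    simp only [sub_self, if_true]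
    push_cast
    ring
  · rw [if_neg (fun hc => h (sub_eq_zero.1 hc).symm), if_neg h, zero_mul]

theorem summable_smul_of_orthogonal {ι H : Type*} [NormedAddCommGroup H] [InnerProductSpace ℂ H]
    [CompleteSpace H] {V : ι → H} (hV : ∀ i j, i ≠ j → inner ℂ (V i) (V j) = 0)
    (hV0 : ∀ i, V i ≠ 0) {a : ι → ℂ} (ha : Summable fun i => ‖a i‖ ^ 2 * ‖V i‖ ^ 2) :
    Summable fun i => a i • V i := by
  have hn : ∀ i, ((‖V i‖ : ℝ) : ℂ) ≠ 0 := fun i => by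
    exact_mod_cast (norm_pos_iff.2 (hV0 i)).ne'
  have horth : Orthonormal ℂ fun i => ((‖V i‖ : ℝ) : ℂ)⁻¹ • V i := by
    refine ⟨fun i => ?_, fun i j hij => ?_⟩
    · rw [norm_smul, norm_inv, Complex.norm_real, norm_norm,
        inv_mul_cancel₀ (norm_pos_iff.2 (hV0 i)).ne']
    · simp only [inner_smul_left, inner_smul_right]
      rw [hV i j hij, mul_zero, mul_zero]
  have key := (horth.orthogonalFamily.summable_iff_norm_sq_summable
    fun i => a i * ((‖V i‖ : ℝ) : ℂ)).2 (by simpa [mul_pow] using! ha)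
  refine key.congr fun i => ?_
  simp only [LinearIsometry.toSpanSingleton_apply]
  rw [smul_smul, mul_assoc, mul_inv_cancel₀ (hn i), mul_one]

/-- Pairing with a fixed `χ` is continuous on `L²`. It is used to pass weak identities to the limit
term by term. -/
theorem hasSum_integral_re {ι α : Type*} [MeasurableSpace α] {μ : Measure α} {w : ι → α → ℂ}
    (hw : ∀ i, MemLp (w i) 2 μ) {W : α → ℂ} (hW : MemLp W 2 μ)
    (hs : HasSum (fun i => (hw i).toLp _) (hW.toLp _)) {χ : α → ℝ} (hχ : MemLp χ 2 μ) :
    HasSum (fun i => ∫ x, (w i x).re * χ x ∂μ) (∫ x, (W x).re * χ x ∂μ) := by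
  have hχc : MemLp (fun x => (χ x : ℂ)) 2 μ := hχ.ofReal
  have hre : ∀ v : α → ℂ, ∀ hv : MemLp v 2 μ,
      (inner ℂ (hχc.toLp _) (hv.toLp _)).re = ∫ x, (v x).re * χ x ∂μ := by
    intro v hv
    have h1 : inner ℂ (hχc.toLp _) (hv.toLp _) = ∫ x, v x * (χ x : ℂ) ∂μ := by
      rw [L2.inner_def]
      refine integral_congr_ae ?_
      filter_upwards [hχc.coeFn_toLp, hv.coeFn_toLp] with x h1 h2
      rw [h1, h2, RCLike.inner_apply, Complex.conj_ofReal]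
    rw [h1]
    refine (Complex.reCLM.integral_comp_comm (hv.integrable_mul hχc)).symm.trans ?_
    exact integral_congr_ae (Filter.Eventually.of_forall fun x => by simp)
  have key := (hs.mapL (innerSL ℂ (hχc.toLp _))).mapL Complex.reCLM
  simpa [hre] using key

/-- Sums of the modes with coefficients of Sobolev type converge weakly in `L²`. -/
theorem exists_sum_surfaceMode (hη : Continuous η) {a c : (Fin d → ℤ) → ℂ}
    (hc : Summable fun ξ => bracket ξ * ‖c ξ‖ ^ 2) (hac : ∀ ξ, ‖a ξ‖ ≤ bracket ξ * ‖c ξ‖) :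
    ∃ W : Torus d × ℝ → ℂ, MemLp W 2 (volume.restrict (fluidDomain ⊤ η)) ∧
      ∀ χ : Torus d × ℝ → ℝ, MemLp χ 2 (volume.restrict (fluidDomain ⊤ η)) →
        HasSum (fun ξ => ∫ p in fluidDomain ⊤ η, (a ξ * surfaceMode η ξ p).re * χ p)
          (∫ p in fluidDomain ⊤ η, (W p).re * χ p) := by
  have hnorm : ∀ ξ : Fin d → ℤ, ‖(memLp_surfaceMode hη ξ).toLp _‖ ^ 2 =
      (2 * Real.pi) ^ d / (2 * bracket ξ) := fun ξ => by
    have := inner_surfaceMode hη ξ ξ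
    rw [inner_self_eq_norm_sq_to_K, if_pos rfl] at this
    exact Complex.ofReal_injective (by rw [Complex.ofReal_pow]; exact this)
  have hsum : Summable fun ξ => a ξ • (memLp_surfaceMode hη ξ).toLp _ := by
    refine summable_smul_of_orthogonal
      (fun i j hij => by rw [inner_surfaceMode hη, if_neg hij]) (fun ξ h0 => ?_) ?_
    · have := hnorm ξ
      rw [h0, norm_zero] at this
      have hb := bracket_pos ξ
      have : 0 < (2 * Real.pi) ^ d / (2 * bracket ξ) := by positivity
      simp_all
    -- The loss `⟨ξ⟩²` from the coefficients meets the gain `1 / (2⟨ξ⟩)` in the squared norm of the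
    -- mode, leaving the assumed weight `⟨ξ⟩`.
    · refine Summable.of_nonneg_of_le (fun ξ => by positivity) (fun ξ => ?_)
        (hc.mul_left ((2 * Real.pi) ^ d / 2))
      rw [hnorm]
      have hb := bracket_pos ξ
      have h1 : ‖a ξ‖ ^ 2 ≤ (bracket ξ * ‖c ξ‖) ^ 2 :=
        pow_le_pow_left₀ (norm_nonneg _) (hac ξ) 2
      calc ‖a ξ‖ ^ 2 * ((2 * Real.pi) ^ d / (2 * bracket ξ))
          ≤ (bracket ξ * ‖c ξ‖) ^ 2 * ((2 * Real.pi) ^ d / (2 * bracket ξ)) := by gcongr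
        _ = (2 * Real.pi) ^ d / 2 * (bracket ξ * ‖c ξ‖ ^ 2) := by field_simp
  obtain ⟨W, hW⟩ := hsum
  refine ⟨W, Lp.memLp W, fun χ hχ => ?_⟩
  refine hasSum_integral_re (w := fun ξ p => a ξ * surfaceMode η ξ p)
    (fun ξ => (memLp_surfaceMode hη ξ).const_mul (a ξ)) (Lp.memLp W) ?_ hχ
  rw [Lp.toLp_coeFn]
  exact hW

/-- The gradient of `Re (a e^{i x·ξ + ⟨ξ⟩ (y - η(x))})`. -/
noncomputable def surfaceModeGrad (η : Torus d → ℝ) (ξ : Fin d → ℤ) (a : ℂ) (p : Torus d × ℝ) :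
    EuclideanSpace ℝ (Option (Fin d)) :=
  WithLp.toLp 2 fun k => k.elim (a * bracket ξ * surfaceMode η ξ p).re fun j =>
    (a * (ξ j * Complex.I) * surfaceMode η ξ p).re -
      horizontalDeriv η j p.1 * (a * bracket ξ * surfaceMode η ξ p).re

theorem surfaceMode_add_displacement (ξ : Fin d → ℤ) (p : Torus d × ℝ) (j : Fin d) (t : ℝ) :
    surfaceMode η ξ (p + displacement (some j) t) =
      torusChar ξ p.1 * (Complex.exp ((ξ j * t : ℝ) * Complex.I) *
        (Real.exp (bracket ξ * (p.2 - η (p.1 + Pi.single j (t : AddCircle (2 * Real.pi))))) : ℂ)) := by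
  have e : p + displacement (some j) t =
      (p.1 + Pi.single j (t : AddCircle (2 * Real.pi)), p.2) := by
    ext <;> simp [displacement]
  rw [e, surfaceMode, torusChar_add_single, mul_assoc]

theorem hasDerivAt_surfaceMode {ξ : Fin d → ℤ} {p : Torus d × ℝ} {j : Fin d}
    (hp : HasDerivAt (fun t : ℝ => η (p.1 + Pi.single j (t : AddCircle (2 * Real.pi))))
      (horizontalDeriv η j p.1) 0) (a : ℂ) :
    HasDerivAt (fun t => (a * surfaceMode η ξ (p + displacement (some j) t)).re)
      (surfaceModeGrad η ξ a p (some j)) 0 := by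
  have h1 : HasDerivAt (fun t : ℝ => Complex.exp ((ξ j * t : ℝ) * Complex.I)) (ξ j * Complex.I) 0 := by
    have h2 : HasDerivAt (fun t : ℝ => (((ξ j * t : ℝ) : ℂ) * Complex.I)) (ξ j * Complex.I) 0 := by
      have := (((hasDerivAt_id (0 : ℝ)).const_mul (ξ j : ℝ)).ofReal_comp).mul_const Complex.I
      simpa using this
    simpa using h2.cexp
  have h3 : HasDerivAt (fun t : ℝ =>
      Real.exp (bracket ξ * (p.2 - η (p.1 + Pi.single j (t : AddCircle (2 * Real.pi))))))
      (Real.exp (bracket ξ * (p.2 - η p.1)) * (bracket ξ * -horizontalDeriv η j p.1)) 0 := by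
    have := ((hp.const_sub p.2).const_mul (bracket ξ)).exp
    simpa using this
  have h4 := (((h1.mul h3.ofReal_comp).const_mul (torusChar ξ p.1)).const_mul a)
  have h5 := Complex.reCLM.hasFDerivAt.comp_hasDerivAt (0 : ℝ) h4
  refine (h5.congr_deriv ?_).congr_of_eventuallyEq (Filter.Eventually.of_forall fun t => ?_)
  · simp only [surfaceModeGrad, Option.elim, surfaceMode, Complex.reCLM_apply]
    rw [← Complex.re_ofReal_mul, ← Complex.sub_re]
    congr 1
    simp
    ring
  · simp only [surfaceMode_add_displacement]
    rfl

theorem abs_exp_sub_exp_le {x y B : ℝ} (hx : x ≤ B) (hy : y ≤ B) :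
    |Real.exp x - Real.exp y| ≤ Real.exp B * |x - y| :=
  Convex.norm_image_sub_le_of_norm_deriv_le (f := Real.exp) (s := Set.Iic B)
    (fun _ _ => Real.differentiableAt_exp) (fun z hz => by
      rw [Real.deriv_exp, Real.norm_eq_abs, Real.abs_exp]
      exact Real.exp_le_exp.2 hz) (convex_Iic B) hy hx

/-- The increment splits into one of the phase and one of the real exponential. At heights below `r`
the exponents are bounded above, since `η` is bounded below, so both are linear in `t`. -/
theorem abs_surfaceMode_sub_le {K : NNReal} (hη : LipschitzWith K η) (ξ : Fin d → ℤ) (a : ℂ)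
    (j : Fin d) (r : ℝ) : ∃ C, ∀ p : Torus d × ℝ, p.2 ≤ r → ∀ t : ℝ,
      |(a * surfaceMode η ξ (p + displacement (some j) t)).re - (a * surfaceMode η ξ p).re| ≤
        C * |t| := by
  obtain ⟨N, hN⟩ := exists_forall_le hη.continuous.neg
  set B := Real.exp (bracket ξ * (r + N)) with hB
  have hb := bracket_pos ξ
  refine ⟨‖a‖ * (|(ξ j : ℝ)| * B + B * (bracket ξ * K)), fun p hp t => ?_⟩
  set x' : Torus d := p.1 + Pi.single j (t : AddCircle (2 * Real.pi)) with hx'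
  have hle : ∀ x, bracket ξ * (p.2 - η x) ≤ bracket ξ * (r + N) := fun x =>
    mul_le_mul_of_nonneg_left (by have := hN x; simp only [Pi.neg_apply] at this; linarith) hb.le
  set E' := Real.exp (bracket ξ * (p.2 - η x'))
  set E := Real.exp (bracket ξ * (p.2 - η p.1))
  have hE' : |E'| ≤ B := by
    rw [Real.abs_exp]
    exact Real.exp_le_exp.2 (hle _)
  have hEE : |E' - E| ≤ B * (bracket ξ * (K * |t|)) := by
    refine (abs_exp_sub_exp_le (hle x') (hle p.1)).trans ?_
    refine mul_le_mul_of_nonneg_left ?_ (Real.exp_pos _).le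
    rw [← mul_sub, abs_mul, abs_of_pos hb]
    refine mul_le_mul_of_nonneg_left ?_ hb.le
    have h1 := (hη.comp_add_single p.1 j).dist_le_mul t 0
    simp only [Real.dist_eq, sub_zero, AddCircle.coe_zero, Pi.single_zero, add_zero] at h1
    have h2 : p.2 - η x' - (p.2 - η p.1) = -(η x' - η p.1) := by ring
    rw [h2, abs_neg]
    exact h1
  have hexp : ‖Complex.exp ((ξ j * t : ℝ) * Complex.I) - 1‖ ≤ |(ξ j : ℝ)| * |t| := by
    have := Real.norm_exp_I_mul_ofReal_sub_one_le (x := ξ j * t)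
    rwa [mul_comm Complex.I, Real.norm_eq_abs, abs_mul] at this
  have e1 : a * surfaceMode η ξ (p + displacement (some j) t) - a * surfaceMode η ξ p =
      a * (torusChar ξ p.1 * ((Complex.exp ((ξ j * t : ℝ) * Complex.I) - 1) * (E' : ℂ) +
        ((E' - E : ℝ) : ℂ))) := by
    have h1 : surfaceMode η ξ p = torusChar ξ p.1 * (E : ℂ) := rfl
    rw [surfaceMode_add_displacement, h1]
    change a * (torusChar ξ p.1 * (_ * (E' : ℂ))) - _ = _
    push_cast
    ring
  rw [← Complex.sub_re, e1]
  refine (Complex.abs_re_le_norm _).trans ?_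
  rw [norm_mul, norm_mul, norm_torusChar, one_mul, mul_assoc]
  refine mul_le_mul_of_nonneg_left ((norm_add_le _ _).trans ?_) (norm_nonneg _)
  rw [norm_mul, Complex.norm_real, Complex.norm_real, Real.norm_eq_abs, Real.norm_eq_abs]
  calc _ ≤ |(ξ j : ℝ)| * |t| * B + B * (bracket ξ * (K * |t|)) := by gcongr
    _ = _ := by ring

theorem memLp_horizontalDeriv_mul {K : NNReal} (hη : LipschitzWith K η) (j : Fin d)
    {μ : Measure (Torus d × ℝ)} {v : Torus d × ℝ → ℝ} (hv : MemLp v 2 μ) :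
    MemLp (fun p => horizontalDeriv η j p.1 * v p) 2 μ := by
  have hm : Measurable fun p : Torus d × ℝ => horizontalDeriv η j p.1 :=
    (measurable_horizontalDeriv hη.continuous j).comp measurable_fst
  refine hv.of_le_mul (c := K) (hm.aestronglyMeasurable.mul hv.1)
    (Filter.Eventually.of_forall fun p => ?_)
  rw [norm_mul]
  exact mul_le_mul_of_nonneg_right (abs_horizontalDeriv_le hη j p.1) (norm_nonneg _)

theorem surfaceMode_finiteEnergy {K : NNReal} (hη : LipschitzWith K η) (ξ : Fin d → ℤ) (a : ℂ) :
    HasFiniteEnergy ⊤ η (fun p => (a * surfaceMode η ξ p).re) (surfaceModeGrad η ξ a) ∧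
      HasSurfaceTrace ⊤ η (fun p => (a * surfaceMode η ξ p).re) (surfaceModeGrad η ξ a)
        fun x => (a * torusChar ξ x).re := by
  have hηc := hη.continuous
  have hcont := continuous_surfaceMode hηc ξ
  have hL : ∀ b : ℂ, MemLp (fun p => (b * surfaceMode η ξ p).re) 2
      (volume.restrict (fluidDomain ⊤ η)) := fun b =>
    Complex.reCLM.comp_memLp' ((memLp_surfaceMode hηc ξ).const_mul b)
  have hcn : Continuous fun p => surfaceModeGrad η ξ a p none := by
    simp only [surfaceModeGrad, Option.elim]
    fun_prop
  have key := hasFiniteEnergy_of_lipschitz (u := fun p => (a * surfaceMode η ξ p).re)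
    (g := surfaceModeGrad η ξ a) hηc (by fun_prop)
    (fun j l r => by
      obtain ⟨C, hC⟩ := abs_surfaceMode_sub_le hη ξ a j r
      exact ⟨C, fun p hp => hC p hp.2⟩)
    (fun j => by
      have h1 : ∀ᵐ p : Torus d × ℝ, HasDerivAt
          (fun t : ℝ => η (p.1 + Pi.single j (t : AddCircle (2 * Real.pi))))
          (horizontalDeriv η j p.1) 0 :=
        Measure.quasiMeasurePreserving_fst.ae (ae_hasDerivAt_horizontalDeriv hη j)
      filter_upwards [h1] with p hp
      exact hasDerivAt_surfaceMode hp a)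
    hcn.measurable
    (fun l r => (isCompact_slab d l r).exists_bound_of_continuousOn hcn.continuousOn |>.imp
      fun C hC p hp => hC p ⟨Set.mem_univ _, hp⟩)
    (fun x => ⟨∅, Set.countable_empty, fun y _ => by
      have h1 : HasDerivAt (fun s : ℝ => Real.exp (bracket ξ * (s - η x)))
          (Real.exp (bracket ξ * (y - η x)) * bracket ξ) y := by
        simpa using (((hasDerivAt_id y).sub_const (η x)).const_mul (bracket ξ)).exp
      have h2 := Complex.reCLM.hasFDerivAt.comp_hasDerivAt y
        ((h1.ofReal_comp.const_mul (torusChar ξ x)).const_mul a)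
      refine h2.congr_deriv ?_
      simp only [surfaceModeGrad, Option.elim, surfaceMode, Complex.reCLM_apply]
      congr 1
      push_cast
      ring⟩)
    (memLp_euclidean fun k => by
      cases k with
      | none => exact hL _
      | some j =>
        refine (hL _).sub ?_
        exact memLp_horizontalDeriv_mul hη j (hL _))
  simpa [surfaceMode] using! key

/-- Functions in `H^{1/2}` are traces of functions of finite energy. -/
theorem hasExtension_of_memSobolev {K : NNReal} (hη : LipschitzWith K η) {f : Torus d → ℝ}
    (hf : MemSobolev (1 / 2) f) : HasExtension ⊤ η f := by
  have hηc := hη.continuous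
  set c := torusFourierCoeff f
  have hc : Summable fun ξ => bracket ξ * ‖c ξ‖ ^ 2 := by
    refine hf.2.congr fun ξ => ?_
    rw [bracket, Real.sqrt_eq_rpow]
  have hone : ∀ ξ, ‖c ξ‖ ≤ bracket ξ * ‖c ξ‖ := fun ξ =>
    le_mul_of_one_le_left (norm_nonneg _) (one_le_bracket ξ)
  -- `U` sums the modes, `B` their vertical derivatives, and `A j` the derivatives of the characters
  -- alone; each multiplier is at most `⟨ξ⟩`.
  obtain ⟨U, hU, hUs⟩ := exists_sum_surfaceMode hηc hc (a := c) hone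
  obtain ⟨B, hB, hBs⟩ := exists_sum_surfaceMode hηc hc (a := fun ξ => c ξ * bracket ξ) fun ξ => by
    rw [norm_mul, Complex.norm_real, Real.norm_eq_abs, abs_of_pos (bracket_pos ξ), mul_comm]
  choose A hA hAs using fun j : Fin d => exists_sum_surfaceMode hηc hc
    (a := fun ξ => c ξ * (ξ j * Complex.I)) fun ξ => by
      rw [norm_mul, norm_mul, Complex.norm_I, mul_one, mul_comm]
      refine mul_le_mul_of_nonneg_right ?_ (norm_nonneg _)
      simpa using abs_le_bracket ξ j
  set g : Torus d × ℝ → EuclideanSpace ℝ (Option (Fin d)) := fun p =>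
    WithLp.toLp 2 fun k => k.elim (B p).re fun j =>
      (A j p).re - horizontalDeriv η j p.1 * (B p).re with hg
  have hre : ∀ W : Torus d × ℝ → ℂ, MemLp W 2 (volume.restrict (fluidDomain ⊤ η)) →
      MemLp (fun p => (W p).re) 2 (volume.restrict (fluidDomain ⊤ η)) := fun W hW =>
    Complex.reCLM.comp_memLp' hW
  have hDb : ∀ (j : Fin d) (v : Torus d × ℝ → ℝ), MemLp v 2 (volume.restrict (fluidDomain ⊤ η)) →
      MemLp (fun p => horizontalDeriv η j p.1 * v p) 2 (volume.restrict (fluidDomain ⊤ η)) :=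
    fun j v hv => memLp_horizontalDeriv_mul hη j hv
  have hgL : MemLp g 2 (volume.restrict (fluidDomain ⊤ η)) := memLp_euclidean fun k => by
    cases k with
    | none => exact hre B hB
    | some j => exact (hre _ (hA j)).sub (hDb j _ (hre B hB))
  have hgs : ∀ (k : Option (Fin d)) (χ : Torus d × ℝ → ℝ),
      MemLp χ 2 (volume.restrict (fluidDomain ⊤ η)) →
      HasSum (fun ξ => ∫ p in fluidDomain ⊤ η, surfaceModeGrad η ξ (c ξ) p k * χ p)
        (∫ p in fluidDomain ⊤ η, g p k * χ p) := by
    intro k χ hχ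
    cases k with
    | none => exact hBs χ hχ
    | some j =>
      have hsplit : ∀ V W : Torus d × ℝ → ℝ, MemLp V 2 (volume.restrict (fluidDomain ⊤ η)) →
          MemLp W 2 (volume.restrict (fluidDomain ⊤ η)) →
          ∫ p in fluidDomain ⊤ η, (V p - horizontalDeriv η j p.1 * W p) * χ p =
            (∫ p in fluidDomain ⊤ η, V p * χ p) -
              ∫ p in fluidDomain ⊤ η, W p * (horizontalDeriv η j p.1 * χ p) := by
        intro V W hV hW
        refine Eq.trans ?_ (integral_sub (hV.integrable_mul hχ) (hW.integrable_mul (hDb j χ hχ)))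
        exact integral_congr_ae (Filter.Eventually.of_forall fun p => by
          ring)
      -- The bounded factor `∂_j η` is moved onto the test function, so the convergence of `B`
      -- suffices.
      have h1 := (hAs j χ hχ).sub (hBs _ (hDb j χ hχ))
      rw [← hsplit _ _ (hre _ (hA j)) (hre B hB)] at h1
      refine h1.congr_fun fun ξ => ?_
      exact hsplit _ _ (hre _ ((memLp_surfaceMode hηc ξ).const_mul _))
        (hre _ ((memLp_surfaceMode hηc ξ).const_mul _))
  refine ⟨fun p => (U p).re, g, ⟨(hre U hU).depth, hgL, fun k ζ hζ => ?_⟩, hf.1, fun ζ hζ => ?_⟩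
  · have h1 := hUs _ ((hζ.torusPartial k).memLp.restrict _)
    have h2 := (hgs k _ (hζ.memLp.restrict _)).neg
    -- Each mode satisfies the identity, so both sides are sums of the same series.
    exact (h1.congr_fun fun ξ =>
      ((surfaceMode_finiteEnergy hη ξ (c ξ)).1.weak_deriv k ζ hζ).symm).unique h2
  · have i1 := (hre U hU).integrable_mul ((hζ.torusPartial none).memLp.restrict _)
    have i2 := (hgL.coord none).integrable_mul (hζ.memLp.restrict _)
    have h1 := (hUs _ ((hζ.torusPartial none).memLp.restrict _)).add
      (hgs none _ (hζ.memLp.restrict _))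
    have hcχ : Continuous fun x => ζ (x, η x) := hζ.continuous.comp (by fun_prop)
    have hchar : ∀ ξ, MemLp (fun x => c ξ * torusChar ξ x) 2 volume := fun ξ =>
      (by fun_prop : Continuous fun x => c ξ * torusChar ξ x).memLp_of_hasCompactSupport
        (HasCompactSupport.of_compactSpace _)
    -- The surface terms converge because the Fourier series of `f` converges in `L²` of the torus.
    have h2 := hasSum_integral_re hchar (W := fun x => (f x : ℂ)) hf.1.ofReal
      (hasSum_torusFourier hf.1.ofReal hchar) (χ := fun x => ζ (x, η x))
      (hcχ.memLp_of_hasCompactSupport (HasCompactSupport.of_compactSpace _))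
    simp only [Complex.ofReal_re] at h2
    refine (integral_add i1 i2).trans (h1.unique (h2.congr_fun fun ξ => ?_))
    obtain ⟨he, ht⟩ := surfaceMode_finiteEnergy hη ξ (c ξ)
    rw [← ht.2 ζ hζ]
    exact (integral_add ((hζ.torusPartial none).integrableOn_mul EReal.zero_lt_top hηc
      he.memLp_local) (hζ.integrableOn_mul EReal.zero_lt_top hηc
      fun R => (he.memLp_grad.coord none).depth R)).symm

end Modes

/-! ### Energy bound for `η` and conclusion -/

theorem HasExtension.of_top {d : ℕ} {h : EReal} {η f : Torus d → ℝ} (hη : Continuous η)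
    (hf : HasExtension ⊤ η f) : HasExtension h η f := by
  obtain ⟨F, gF, hF, hFf⟩ := hf
  exact ⟨F, gF, hF.of_top hη, hFf.of_top hη⟩

/-- The competitor is `max y c`. Its energy at depth `h` is at most that in infinite depth, and the
zero mean of `η` evaluates the latter. -/
theorem dirichletToNeumann_surface_le {d : ℕ} {h : EReal} (hh : 0 < h) {η : Torus d → ℝ}
    (hη : Continuous η) (hmean : ∫ x : Torus d, η x = 0) {c : ℝ} (hc : ∀ x, c ≤ η x) :
    0 ≤ dirichletToNeumann h η η η ∧
      dirichletToNeumann h η η η ≤ -c * volume.real (Set.univ : Set (Torus d)) := by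
  obtain ⟨g, hg, hgη, he⟩ := hasFiniteEnergy_max hη hc
  obtain ⟨h1, h2⟩ := dirichletToNeumann_self_le hh hη (hg.of_top hη) (hgη.of_top hη)
  refine ⟨h1, h2.trans ?_⟩
  have hηi : Integrable η :=
    hη.integrable_of_hasCompactSupport (HasCompactSupport.of_compactSpace _)
  have e : ∫ x, (η x - c) = -c * volume.real (Set.univ : Set (Torus d)) := by
    rw [integral_sub hηi (integrable_const c), hmean, integral_const, smul_eq_mul]
    ring
  rw [← e, ← he]
  exact setIntegral_mono_set ((memLp_two_iff_integrable_sq_norm hg.memLp_grad.1).1 hg.memLp_grad)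
    (Filter.Eventually.of_forall fun p => sq_nonneg _)
    fluidDomain_subset_top.eventuallyLE

theorem proposition4p2 (d : ℕ) (hd : 1 ≤ d) (h : EReal) (hh : 0 < h)
    (η : Torus d → ℝ) (hLip : ∃ K : NNReal, LipschitzWith K η)
    (hmean : ∫ x : Torus d, η x = 0)
    (hinf : -(h / 2) < ((⨅ x : Torus d, η x : ℝ) : EReal)) :
    -- `∫ f G(η)ψ` is well defined
    (∀ ψ f : Torus d → ℝ, MemSobolev (1 / 2) ψ → MemSobolev (1 / 2) f →
      ∃! a : ℝ, IsDNPairing h η ψ f a) ∧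
    (∀ ψ : Torus d → ℝ, MemSobolev (1 / 2) ψ →
      |dirichletToNeumann h η ψ η| ≤
        Real.sqrt (dirichletToNeumann h η η η) * Real.sqrt (dirichletToNeumann h η ψ ψ)) ∧
    (h < ⊤ →
      0 ≤ dirichletToNeumann h η η η ∧
        dirichletToNeumann h η η η ≤ h.toReal * volume.real (Set.univ : Set (Torus d))) ∧
    (h = ⊤ →
      0 ≤ dirichletToNeumann h η η η ∧
        dirichletToNeumann h η η η ≤
          |⨅ x : Torus d, η x| * volume.real (Set.univ : Set (Torus d))) := by
  obtain ⟨K, hK⟩ := hLip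
  have hη := hK.continuous
  have hm : ∀ x, (⨅ x, η x) ≤ η x := fun x => ciInf_le (isCompact_range hη).bddBelow x
  have hext : ∀ ψ, MemSobolev (1 / 2) ψ → HasExtension h η ψ := fun ψ hψ =>
    (hasExtension_of_memSobolev hK hψ).of_top hη
  -- The truncated height serves as the extension, so membership of `η` in `H^{1/2}` need not be
  -- checked.
  have hextη : HasExtension h η η := by
    obtain ⟨g, hg, hgη, -⟩ := hasFiniteEnergy_max hη hm
    exact HasExtension.of_top hη ⟨_, g, hg, hgη⟩
  refine ⟨fun ψ f hψ hf => existsUnique_isDNPairing hh hη (hext ψ hψ) (hext f hf),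
    fun ψ hψ => abs_dirichletToNeumann_le hh hη (hext ψ hψ) hextη, fun hfin => ?_, fun htop => ?_⟩
  · lift h to ℝ using ⟨hfin.ne, (EReal.bot_lt_zero.trans hh).ne'⟩
    have hh' : 0 < h := by exact_mod_cast hh
    have hinf' : -(h / 2) < ⨅ x, η x := by
      have e : ((h : EReal) / 2) = ((h / 2 : ℝ) : EReal) := (EReal.coe_div h 2).symm
      rw [e] at hinf
      exact_mod_cast hinf
    -- At the level `c = -h` the truncation is inactive in the domain, so the competitor is the
    -- height `y` itself; `-h ≤ η` follows from `-h/2 < inf η`.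
    have := dirichletToNeumann_surface_le hh hη hmean (c := -h) fun x => by
      linarith [hm x]
    simpa using this
  · obtain ⟨h1, h2⟩ := dirichletToNeumann_surface_le hh hη hmean hm
    exact ⟨h1, h2.trans (mul_le_mul_of_nonneg_right (neg_le_abs _) measureReal_nonneg)⟩
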